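/- **Conventions.** Let $Q$ be a finite quiver with vertex set $I$, arrows also denoted $Q$, and head and tail maps $h,t:Q\to I$. Its double $\overline Q$ has in addition, for each $a\in Q$, a dual arrow $a^*$ with the same end points and the opposite direction. Let $\mathbb{C}\overline Q$ be its path algebra (paths are written from right to left), with idempotents $e_i$, $i\in I$, graded by the number of dual arrows: $\mathbb{C}\overline Q=\bigoplus_r\mathbb{C}\overline Q^r$. Let $\mathcal{V}Q$ be the graded vector space obtained from $\mathbb{C}\overline Q$ by dividing out the linear span of all $PR-(-1)^{pr}RP$ with $P\in\mathbb{C}\overline Q^p$, $R\in\mathbb{C}\overline Q^r$; paths that are not closed are zero in $\mathcal{V}Q$. For an arrow $w$ of $\overline Q$, the superderivative $D_w:\mathcal{V}Q\to\mathbb{C}\overline Q$ is given on closed paths by $$D_w(x_1\cdots x_n)=\sum_{x_i=w}(-1)^{\lambda_i\mu_i}x_{i+1}\cdots x_nx_1\cdots x_{i-1},$$ where $\lambda_i$ (resp. $\mu_i$) is the number of dual arrows among $x_{i+1},\dots,x_n$ (resp. $x_1,\dots,x_i$), and an empty product is the trivial path at $t(w)$. For $\gamma\in\mathcal{V}^rQ$,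 $\delta\in\mathcal{V}^sQ$ the Schouten bracket is the class in $\mathcal{V}Q$ of $$[\gamma,\delta]=\sum_{a\in Q}\bigl(D_{a^*}(\gamma)D_a(\delta)-(-1)^{(r-1)(s-1)}D_{a^*}(\delta)D_a(\gamma)\bigr).$$ A *Poisson structure on $\mathbb{C}Q$* is an element $\Pi\in\mathcal{V}^2Q$ with $[\Pi,\Pi]=0$. **Contraction.** Let $j\in I$ and let $a_1,\dots,a_s\in Q$ be arrows with $h(a_m)=j$ and $t(a_m)=v_m$, where $v_m\neq j$ for all $m$ and the $v_m$ are pairwise distinct. The quiver $Q'$ has vertices $I\setminus\{j\}$ and the following arrows: * (i) each $b\in Q$ with $h(b)\ne j$ and $t(b)\neq j$ is kept; * (ii) the arrows $a_1,\dots,a_s$ are removed; * (iii) each $b$ with $t(b)=j$, $h(b)\ne j$ is replaced by $s$ arrows, from $v_m$ to $h(b)$, $m=1,\dots,s$; * (iv) each $b\notin\{a_1,\dots,a_s\}$ with $h(b)=j$, $t(b)\neq j$ is replaced by $s$ arrows, from $t(b)$ to $v_m$, $m=1,\dots,s$; * (v) each $b$ with $h(b)=t(b)=j$ is replaced by $s^2$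 arrows, one from $v_n$ to $v_m$ for each pair $(m,n)$. For $b\in Q\setminus\{a_1,\dots,a_s\}$ write $c_{b,i}$ for the arrows of $Q'$ that replace $b$ (just $b$ itself in case (i)). **Substitution.** For $\Pi\in\mathcal{V}Q$ let $\Pi'\in\mathcal{V}Q'$ be obtained by writing $\Pi$ as a linear combination of closed paths of $\overline Q$ and substituting in them: $\sum_ic_{b,i}$ for $b$ and $\sum_ic_{b,i}^*$ for $b^*$, if $b\in Q\setminus\{a_1,\dots,a_s\}$; $e_{v_m}$ for $a_m$; and for $a_m^*$ $$e_{v_m}\sum_{t(b)=j}\ \sum_{i,l}c_{b,i}^*c_{b,l}\;-\;e_{v_m}\sum_{\substack{h(b)=j\\ b\notin\{a_1,\dots,a_s\}}}\ \sum_{i,l}c_{b,i}c_{b,l}^*.$$ (A trivial path $e_i$ with $i\ne j$ is kept and $e_j$ becomes $\sum_me_{v_m}$. The result does not depend on the choice of the closed paths.) **Proposition.** If $\Pi$ is a Poisson structure on $\mathbb{C}Q$, then $\Pi'$ is a Poisson structure on $\mathbb{C}Q'$. -/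

import Mathlib

/-- A quiver with vertex type `V` and set of arrows `E`, given by its head and tail maps. -/
structure ArrowQuiver (V E : Type*) where
  head : E → V
  tail : E → V

namespace ArrowQuiver

variable {V E : Type*}

/-- The double quiver: `Sum.inl a` is the arrow `a`, and `Sum.inr a` is the dual arrow `a*`,
which runs in the opposite direction. -/
def double (Q : ArrowQuiver V E) : ArrowQuiver V (E ⊕ E) where
  head := Sum.elim Q.head Q.tail
  tail := Sum.elim Q.tail Q.head

/-- `Q.IsWalk t w s`: the word `w = x₁ ⋯ xₙ` is a path from `s` to `t`. Paths are written from
right to left, so the tail of `xᵢ` is the head of `xᵢ₊₁`. The empty word is a walk from each vertex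
to itself. -/
def IsWalk (Q : ArrowQuiver V E) : V → List E → V → Prop
  | t, [], s => t = s
  | t, x :: w, s => Q.head x = t ∧ Q.IsWalk (Q.tail x) w s

theorem IsWalk.append {Q : ArrowQuiver V E} {t m s : V} {u w : List E}
    (hu : Q.IsWalk t u m) (hw : Q.IsWalk m w s) : Q.IsWalk t (u ++ w) s := by
  induction u generalizing t with
  | nil => cases hu; exact hw
  | cons x u ih => exact ⟨hu.1, ih hu.2⟩

/-- A path of the quiver, with its end point `tgt` and its starting point `src`. The trivial paths
are those with the empty word. -/
@[ext]
structure Path (Q : ArrowQuiver V E) where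
  tgt : V
  word : List E
  src : V
  isWalk : Q.IsWalk tgt word src

/-- The trivial path at a vertex. -/
def Path.trivial (Q : ArrowQuiver V E) (i : V) : Q.Path := ⟨i, [], i, rfl⟩

/-- An arrow as a path of length one. -/
def Path.ofArrow (Q : ArrowQuiver V E) (x : E) : Q.Path := ⟨Q.head x, [x], Q.tail x, rfl, rfl⟩

/-- Concatenation `p q` of composable paths (first `q`, then `p`). -/
def Path.comp {Q : ArrowQuiver V E} (p q : Q.Path) (h : p.src = q.tgt) : Q.Path :=
  ⟨p.tgt, p.word ++ q.word, q.src, p.isWalk.append (h ▸ q.isWalk)⟩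

/-- The path algebra over the complex numbers: the vector space with basis the paths. -/
def PathAlgebra (Q : ArrowQuiver V E) : Type _ := Q.Path →₀ ℂ

namespace PathAlgebra

variable (Q : ArrowQuiver V E)

noncomputable instance : AddCommGroup Q.PathAlgebra := inferInstanceAs (AddCommGroup (Q.Path →₀ ℂ))

noncomputable instance : Module ℂ Q.PathAlgebra := inferInstanceAs (Module ℂ (Q.Path →₀ ℂ))

variable {Q}

/-- The basis element of the path algebra given by a path. -/
noncomputable def ofPath (p : Q.Path) : Q.PathAlgebra := Finsupp.single p 1

/-- The idempotent at a vertex. -/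
noncomputable def idem (Q : ArrowQuiver V E) (i : V) : Q.PathAlgebra := ofPath (Path.trivial Q i)

/-- An arrow as an element of the path algebra. -/
noncomputable def arrow (Q : ArrowQuiver V E) (x : E) : Q.PathAlgebra := ofPath (Path.ofArrow Q x)

/-- The linear map out of the path algebra with prescribed values on paths. -/
noncomputable def lift {M : Type*} [AddCommGroup M] [Module ℂ M] (f : Q.Path → M) :
    Q.PathAlgebra →ₗ[ℂ] M :=
  Finsupp.linearCombination ℂ f

@[simp]
theorem lift_ofPath {M : Type*} [AddCommGroup M] [Module ℂ M] (f : Q.Path → M) (p : Q.Path) :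
    lift f (ofPath p) = f p :=
  (Finsupp.linearCombination_single ℂ 1 p).trans (one_smul ℂ _)

theorem hom_ext {M : Type*} [AddCommGroup M] [Module ℂ M] {f g : Q.PathAlgebra →ₗ[ℂ] M}
    (h : ∀ p, f (ofPath p) = g (ofPath p)) : f = g := by
  refine Finsupp.lhom_ext' fun p => LinearMap.ext_ring ?_
  exact h p

theorem induction_on {P : Q.PathAlgebra → Prop} (x : Q.PathAlgebra) (h0 : P 0)
    (hadd : ∀ x y, P x → P y → P (x + y)) (hsmul : ∀ (c : ℂ) (p : Q.Path), P (c • ofPath p)) :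
    P x := by
  refine Finsupp.induction_linear x h0 hadd fun p c => ?_
  have h := hsmul c p
  have e : c • ofPath p = (Finsupp.single p c : Q.Path →₀ ℂ) := by
    change c • (Finsupp.single p 1 : Q.Path →₀ ℂ) = _
    simp
  rwa [e] at h

variable [DecidableEq V]

/-- Multiplication of the path algebra: concatenation of paths, and `0` if the paths cannot be
concatenated. -/
noncomputable def mulHom : Q.PathAlgebra →ₗ[ℂ] Q.PathAlgebra →ₗ[ℂ] Q.PathAlgebra :=
  lift fun p => lift fun q => if h : p.src = q.tgt then ofPath (p.comp q h) else 0

noncomputable instance : Mul Q.PathAlgebra := ⟨fun x y => mulHom x y⟩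

theorem mul_def (x y : Q.PathAlgebra) : x * y = mulHom x y := rfl

theorem ofPath_mul_ofPath (p q : Q.Path) :
    ofPath p * ofPath q = if h : p.src = q.tgt then ofPath (p.comp q h) else 0 := by
  simp [mul_def, mulHom]

theorem trivial_mul (i : V) (p : Q.Path) :
    ofPath (Path.trivial Q i) * ofPath p = if i = p.tgt then ofPath p else 0 := by
  rw [ofPath_mul_ofPath]
  by_cases h : i = p.tgt
  · subst h
    simp [Path.trivial, Path.comp]
  · simp [Path.trivial, h]

theorem mul_trivial (i : V) (p : Q.Path) :
    ofPath p * ofPath (Path.trivial Q i) = if i = p.src then ofPath p else 0 := by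
  rw [ofPath_mul_ofPath]
  by_cases h : i = p.src
  · subst h
    simp [Path.trivial, Path.comp]
  · simp [Path.trivial, h, Ne.symm h]

variable [Fintype V]

noncomputable instance : One Q.PathAlgebra := ⟨∑ i : V, ofPath (Path.trivial Q i)⟩

protected theorem one_mul (x : Q.PathAlgebra) : 1 * x = x := by
  suffices h : mulHom (1 : Q.PathAlgebra) = LinearMap.id from congrArg (fun f => f x) h
  refine hom_ext fun p => ?_
  rw [show (1 : Q.PathAlgebra) = ∑ i : V, ofPath (Path.trivial Q i) from rfl, map_sum,
    LinearMap.sum_apply]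
  simp only [← mul_def, trivial_mul]
  simp

protected theorem mul_one (x : Q.PathAlgebra) : x * 1 = x := by
  suffices h : mulHom.flip (1 : Q.PathAlgebra) = LinearMap.id from congrArg (fun f => f x) h
  refine hom_ext fun p => ?_
  rw [LinearMap.flip_apply,
    show (1 : Q.PathAlgebra) = ∑ i : V, ofPath (Path.trivial Q i) from rfl, map_sum]
  simp only [← mul_def, mul_trivial]
  simp

protected theorem mul_assoc (x y z : Q.PathAlgebra) : x * y * z = x * (y * z) := by
  simp only [mul_def]
  induction x using induction_on with
  | h0 => simp
  | hadd x x' hx hx' => simp only [map_add, LinearMap.add_apply, hx, hx']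
  | hsmul a p =>
  induction y using induction_on with
  | h0 => simp
  | hadd y y' hy hy' => simp only [map_add, LinearMap.add_apply, hy, hy']
  | hsmul b q =>
  induction z using induction_on with
  | h0 => simp
  | hadd z z' hz hz' => simp only [map_add, hz, hz']
  | hsmul c r =>
  simp only [map_smul, LinearMap.smul_apply]
  congr 3
  rw [← mul_def, ← mul_def, ← mul_def, ← mul_def, ofPath_mul_ofPath p q, ofPath_mul_ofPath q r]
  have mz (x : Q.PathAlgebra) : x * 0 = 0 := by simp [mul_def]
  have zm (x : Q.PathAlgebra) : 0 * x = 0 := by simp [mul_def]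
  by_cases h1 : p.src = q.tgt <;> by_cases h2 : q.src = r.tgt <;>
    simp [h1, h2, ofPath_mul_ofPath, Path.comp, mz, zm]

noncomputable instance : Ring Q.PathAlgebra :=
  { (inferInstance : AddCommGroup Q.PathAlgebra) with
    mul := (· * ·)
    one := 1
    mul_assoc := PathAlgebra.mul_assoc
    one_mul := PathAlgebra.one_mul
    mul_one := PathAlgebra.mul_one
    left_distrib := fun x y z => by simp [mul_def]
    right_distrib := fun x y z => by simp [mul_def]
    zero_mul := fun x => by simp [mul_def]
    mul_zero := fun x => by simp [mul_def] }

theorem smul_mul_eq (c : ℂ) (x y : Q.PathAlgebra) : (c • x) * y = c • (x * y) := by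
  simp [mul_def]

theorem mul_smul_eq (c : ℂ) (x y : Q.PathAlgebra) : x * (c • y) = c • (x * y) := by
  simp [mul_def]

end PathAlgebra

open PathAlgebra

/-! ### Noncommutative polyvector fields and the Schouten bracket -/

/-- The number of dual arrows in a word in the arrows of the double quiver. -/
def dualCount (w : List (E ⊕ E)) : ℕ := w.countP Sum.isRight

theorem dualCount_append (u w : List (E ⊕ E)) :
    dualCount (u ++ w) = dualCount u + dualCount w := List.countP_append

/-- The homogeneous part of degree `r` of the path algebra of the double quiver, spanned by the
paths with exactly `r` dual arrows. -/
noncomputable def homogeneous (Q : ArrowQuiver V E) (r : ℕ) : Submodule ℂ Q.double.PathAlgebra :=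
  Submodule.span ℂ {x | ∃ p : Q.double.Path, dualCount p.word = r ∧ x = ofPath p}

section Schouten

variable [DecidableEq V] [Fintype V]

/-- The linear span of all `P R - (-1)^(p r) R P`, with `P` homogeneous of degree `p` and `R`
homogeneous of degree `r`. -/
noncomputable def superCommutators (Q : ArrowQuiver V E) : Submodule ℂ Q.double.PathAlgebra :=
  Submodule.span ℂ {x | ∃ (p r : ℕ) (P R : Q.double.PathAlgebra),
    P ∈ Q.homogeneous p ∧ R ∈ Q.homogeneous r ∧ x = P * R - (-1 : ℂ) ^ (p * r) • (R * P)}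

/-- The space of noncommutative polyvector fields of `Q` (graded necklaces): the path algebra of
the double quiver modulo supercommutators. -/
abbrev Polyvector (Q : ArrowQuiver V E) : Type _ := Q.double.PathAlgebra ⧸ Q.superCommutators

/-- The class of an element of the path algebra of the double quiver. -/
noncomputable def toPolyvector (Q : ArrowQuiver V E) : Q.double.PathAlgebra →ₗ[ℂ] Q.Polyvector :=
  Q.superCommutators.mkQ

/-- The polyvector fields of degree `r`. -/
noncomputable def polyvectorDegree (Q : ArrowQuiver V E) (r : ℕ) : Submodule ℂ Q.Polyvector :=
  (Q.homogeneous r).map Q.toPolyvector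

/-- To check that a linear map vanishes on supercommutators it is enough to look at paths. -/
theorem superCommutators_le_ker {Q : ArrowQuiver V E} {M : Type*} [AddCommGroup M] [Module ℂ M]
    (f : Q.double.PathAlgebra →ₗ[ℂ] M)
    (h : ∀ p r : Q.double.Path, f (ofPath p * ofPath r) =
      (-1 : ℂ) ^ (dualCount p.word * dualCount r.word) • f (ofPath r * ofPath p)) :
    Q.superCommutators ≤ LinearMap.ker f := by
  refine Submodule.span_le.2 ?_
  rintro _ ⟨m, n, P, R, hP, hR, rfl⟩
  rw [SetLike.mem_coe, LinearMap.mem_ker, map_sub, map_smul, sub_eq_zero]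
  induction hP using Submodule.span_induction with
  | zero => simp
  | add x y _ _ hx hy => rw [add_mul, mul_add, map_add, map_add, hx, hy, smul_add]
  | smul c x _ hx => rw [smul_mul_eq, mul_smul_eq, map_smul, map_smul, hx, smul_comm]
  | mem x hx =>
    obtain ⟨p, rfl, rfl⟩ := hx
    induction hR using Submodule.span_induction with
    | zero => simp
    | add x y _ _ hx hy => rw [add_mul, mul_add, map_add, map_add, hx, hy, smul_add]
    | smul c x _ hx => rw [smul_mul_eq, mul_smul_eq, map_smul, map_smul, hx, smul_comm]
    | mem y hy =>
      obtain ⟨r, rfl, rfl⟩ := hy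
      exact h p r

section Derivative

open Classical in
/-- The `i`-th term (counting from `0`) of the superderivative of the closed word `x` with respect
to the letter `w`. If the `i`-th letter is `w`, it is the rotated word starting after that letter
and ending before it, with its sign. The idempotent only matters if this word is empty. -/
noncomputable def superDerivTerm (Q : ArrowQuiver V E) (w : E ⊕ E) (x : List (E ⊕ E)) (i : ℕ) :
    Q.double.PathAlgebra :=
  if x[i]? = some w then
    (-1 : ℂ) ^ (dualCount (x.drop (i + 1)) * dualCount (x.take (i + 1))) •
      (idem Q.double (Q.double.tail w) *
        ((x.drop (i + 1) ++ x.take i).map (arrow Q.double)).prod)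
  else 0

/-- The superderivative of a path; it is zero on paths that are not closed, since these vanish as
polyvector fields. -/
noncomputable def superDerivPath (Q : ArrowQuiver V E) (w : E ⊕ E) (p : Q.double.Path) :
    Q.double.PathAlgebra :=
  if p.tgt = p.src then ∑ i ∈ Finset.range p.word.length, Q.superDerivTerm w p.word i else 0

theorem superDerivPath_closed (Q : ArrowQuiver V E) (w : E ⊕ E) {p : Q.double.Path}
    (h : p.tgt = p.src) :
    Q.superDerivPath w p = ∑ i ∈ Finset.range p.word.length, Q.superDerivTerm w p.word i :=
  if_pos h

theorem superDerivPath_of_ne (Q : ArrowQuiver V E) (w : E ⊕ E) {p : Q.double.Path}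
    (h : p.tgt ≠ p.src) : Q.superDerivPath w p = 0 :=
  if_neg h

theorem superDerivTerm_append (Q : ArrowQuiver V E) (w : E ⊕ E) (u v : List (E ⊕ E)) (i : ℕ)
    (hi : i < u.length) :
    Q.superDerivTerm w (u ++ v) i =
      (-1 : ℂ) ^ (dualCount u * dualCount v) • Q.superDerivTerm w (v ++ u) (v.length + i) := by
  have e1 : (u ++ v)[i]? = u[i]? := List.getElem?_append_left hi
  have e2 : (v ++ u)[v.length + i]? = u[i]? := by
    rw [List.getElem?_append_right (by omega)]; congr 1; omega
  have hd : (u ++ v).drop (i + 1) = u.drop (i + 1) ++ v := List.drop_append_of_le_length hi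
  have ht : (u ++ v).take (i + 1) = u.take (i + 1) := List.take_append_of_le_length hi
  have ht' : (u ++ v).take i = u.take i := List.take_append_of_le_length hi.le
  have kd : (v ++ u).drop (v.length + i + 1) = u.drop (i + 1) := by
    rw [add_assoc, List.drop_append]; simp
  have kt : (v ++ u).take (v.length + i + 1) = v ++ u.take (i + 1) := by
    rw [add_assoc, List.take_append]; simp
  have kt' : (v ++ u).take (v.length + i) = v ++ u.take i := by
    rw [List.take_append]; simp
  have hu : dualCount u = dualCount (u.take (i + 1)) + dualCount (u.drop (i + 1)) := by
    rw [← dualCount_append, List.take_append_drop]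
  unfold superDerivTerm
  rw [e1, e2, hd, ht, ht', kd, kt, kt', hu, dualCount_append, dualCount_append]
  split_ifs
  · rw [smul_smul, ← pow_add, List.append_assoc]
    congr 1
    generalize dualCount (u.take (i + 1)) = a
    generalize dualCount (u.drop (i + 1)) = b
    generalize dualCount v = c
    have : (a + b) * c + b * (c + a) = (b + c) * a + 2 * (b * c) := by ring
    rw [this, pow_add, pow_mul]
    simp
  · simp

theorem sum_superDerivTerm_append (Q : ArrowQuiver V E) (w : E ⊕ E) (u v : List (E ⊕ E)) :
    ∑ i ∈ Finset.range (u ++ v).length, Q.superDerivTerm w (u ++ v) i =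
      (-1 : ℂ) ^ (dualCount u * dualCount v) •
        ∑ i ∈ Finset.range (v ++ u).length, Q.superDerivTerm w (v ++ u) i := by
  have sq (n : ℕ) : (-1 : ℂ) ^ n * (-1 : ℂ) ^ n = 1 := by rw [← mul_pow]; simp
  rw [List.length_append, List.length_append, Finset.sum_range_add, Finset.sum_range_add, smul_add,
    add_comm]
  congr 1
  · rw [Finset.smul_sum]
    refine Finset.sum_congr rfl fun i hi => ?_
    rw [Q.superDerivTerm_append w v u i (Finset.mem_range.1 hi), smul_smul,
      Nat.mul_comm (dualCount v), sq, one_smul]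
  · rw [Finset.smul_sum]
    exact Finset.sum_congr rfl fun i hi => Q.superDerivTerm_append w u v i (Finset.mem_range.1 hi)

/-- The directional superderivative `D_w`, for an arrow `w` of the double quiver. -/
noncomputable def superDeriv (Q : ArrowQuiver V E) (w : E ⊕ E) :
    Q.Polyvector →ₗ[ℂ] Q.double.PathAlgebra :=
  Q.superCommutators.liftQ (lift (Q.superDerivPath w)) <| by
    refine superCommutators_le_ker _ fun p r => ?_
    rw [ofPath_mul_ofPath, ofPath_mul_ofPath]
    by_cases h1 : p.src = r.tgt <;> by_cases h2 : r.src = p.tgt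
    · rw [dif_pos h1, dif_pos h2, lift_ofPath, lift_ofPath,
        superDerivPath_closed _ _ (p := p.comp r h1) h2.symm,
        superDerivPath_closed _ _ (p := r.comp p h2) h1.symm]
      exact Q.sum_superDerivTerm_append w p.word r.word
    · rw [dif_pos h1, dif_neg h2, lift_ofPath,
        superDerivPath_of_ne _ _ (p := p.comp r h1) (Ne.symm h2), map_zero, smul_zero]
    · rw [dif_neg h1, dif_pos h2, lift_ofPath,
        superDerivPath_of_ne _ _ (p := r.comp p h2) (Ne.symm h1), map_zero, smul_zero]
    · rw [dif_neg h1, dif_neg h2]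
      simp

end Derivative

/-- The Schouten bracket of polyvector fields `γ` of degree `r` and `δ` of degree `s`. -/
noncomputable def schouten [Fintype E] (Q : ArrowQuiver V E) (r s : ℕ) (γ δ : Q.Polyvector) :
    Q.Polyvector :=
  Q.toPolyvector (∑ a : E,
    (Q.superDeriv (Sum.inr a) γ * Q.superDeriv (Sum.inl a) δ -
      (-1 : ℂ) ^ (((r : ℤ) - 1) * ((s : ℤ) - 1)) •
        (Q.superDeriv (Sum.inr a) δ * Q.superDeriv (Sum.inl a) γ)))

/-- A Poisson structure on the path algebra of `Q`: a polyvector field of degree two whose Schouten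
bracket with itself vanishes. -/
def IsPoisson [Fintype E] (Q : ArrowQuiver V E) (P : Q.Polyvector) : Prop :=
  P ∈ Q.polyvectorDegree 2 ∧ Q.schouten 2 2 P P = 0

end Schouten

/-! ### Contraction along several arrows meeting at a vertex -/

/-- Arrows `a₁, …, a_s` which end at the vertex `j` and start at distinct vertices
`v₁, …, v_s` different from `j`. -/
structure Fan (Q : ArrowQuiver V E) (j : V) (s : ℕ) where
  arr : Fin s → E
  head_arr : ∀ m, Q.head (arr m) = j
  tail_ne : ∀ m, Q.tail (arr m) ≠ j
  tail_injective : Function.Injective fun m => Q.tail (arr m)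

variable {Q : ArrowQuiver V E} {j : V} {s : ℕ}

/-- The starting vertex `v_m` of `a_m`, as a vertex of the contracted quiver. -/
def Fan.vertex (a : Q.Fan j s) (m : Fin s) : {i : V // i ≠ j} := ⟨Q.tail (a.arr m), a.tail_ne m⟩

/-- The arrows of the contracted quiver. The arrows `a_m` are removed; an arrow not meeting `j` is
kept; an arrow `b` starting (only) at `j` is replaced by arrows `c_{b,m}` starting at the `v_m`; an
arrow ending (only) at `j` is replaced by arrows `c_{b,m}` ending at the `v_m`; a loop at `j` is
replaced by arrows from `v_n` to `v_m`, one for each pair `(m, n)`. -/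
inductive Fan.Arrow (a : Q.Fan j s) : Type _
  | keep (b : E) (hh : Q.head b ≠ j) (ht : Q.tail b ≠ j)
  | outgoing (b : E) (hh : Q.head b ≠ j) (ht : Q.tail b = j) (m : Fin s)
  | incoming (b : E) (hh : Q.head b = j) (ht : Q.tail b ≠ j) (hb : b ∉ Set.range a.arr) (m : Fin s)
  | loop (b : E) (hh : Q.head b = j) (ht : Q.tail b = j) (m n : Fin s)

/-- The arrow of the original quiver from which an arrow of the contracted quiver arises. -/
def Fan.Arrow.base {a : Q.Fan j s} : a.Arrow → E
  | keep b _ _ => b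
  | outgoing b _ _ _ => b
  | incoming b _ _ _ _ => b
  | loop b _ _ _ _ => b

/-- The indices by which an arrow of the contracted quiver is labelled (head, tail). -/
def Fan.Arrow.label {a : Q.Fan j s} : a.Arrow → Option (Fin s) × Option (Fin s)
  | keep _ _ _ => (none, none)
  | outgoing _ _ _ m => (none, some m)
  | incoming _ _ _ _ m => (some m, none)
  | loop _ _ _ m n => (some m, some n)

instance (a : Q.Fan j s) [Finite E] : Finite a.Arrow :=
  Finite.of_injective (fun c => (c.base, c.label)) fun c d h => by
    cases c <;> cases d <;> simp_all [Fan.Arrow.base, Fan.Arrow.label]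

noncomputable instance (a : Q.Fan j s) [Fintype E] : Fintype a.Arrow := Fintype.ofFinite _

/-- The contracted quiver, with vertices all vertices other than `j`. -/
def contract (Q : ArrowQuiver V E) (a : Q.Fan j s) : ArrowQuiver {i : V // i ≠ j} a.Arrow where
  head
    | .keep b hh _ => ⟨Q.head b, hh⟩
    | .outgoing b hh _ _ => ⟨Q.head b, hh⟩
    | .incoming _ _ _ _ m => a.vertex m
    | .loop _ _ _ m _ => a.vertex m
  tail
    | .keep b _ ht => ⟨Q.tail b, ht⟩
    | .outgoing _ _ _ m => a.vertex m
    | .incoming b _ ht _ _ => ⟨Q.tail b, ht⟩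
    | .loop _ _ _ _ n => a.vertex n

namespace Fan

variable [DecidableEq V] [Fintype V] [Fintype E]

open Classical in
/-- The sum of all arrows `c_{b,i}` into which `b` is decomposed. -/
noncomputable def split (a : Q.Fan j s) (b : E) : (Q.contract a).double.PathAlgebra :=
  ∑ c : a.Arrow with c.base = b, arrow _ (Sum.inl c)

open Classical in
/-- The sum of all dual arrows `c_{b,i}*` of those into which `b` is decomposed. -/
noncomputable def splitDual (a : Q.Fan j s) (b : E) : (Q.contract a).double.PathAlgebra :=
  ∑ c : a.Arrow with c.base = b, arrow _ (Sum.inr c)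

open Classical in
/-- The element substituted for `a_m*`. -/
noncomputable def dualValue (a : Q.Fan j s) (m : Fin s) : (Q.contract a).double.PathAlgebra :=
  idem _ (a.vertex m) * (∑ b : E with Q.tail b = j, a.splitDual b * a.split b) -
    idem _ (a.vertex m) *
      (∑ b : E with Q.head b = j ∧ b ∉ Set.range a.arr, a.split b * a.splitDual b)

open Classical in
/-- The substitution on arrows of the double quiver: `a_m` is replaced by the idempotent at `v_m`,
`a_m*` by `a.dualValue m`, and every other arrow by the sum of the arrows into which it is
decomposed. -/
noncomputable def substArrow (a : Q.Fan j s) : E ⊕ E → (Q.contract a).double.PathAlgebra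
  | .inl b => if h : ∃ m, a.arr m = b then idem _ (a.vertex h.choose) else a.split b
  | .inr b => if h : ∃ m, a.arr m = b then a.dualValue h.choose else a.splitDual b

/-- The substitution on trivial paths: the one at `j` becomes the sum of those at the `v_m`. -/
noncomputable def substVertex (a : Q.Fan j s) (i : V) : (Q.contract a).double.PathAlgebra :=
  if h : i = j then ∑ m, idem _ (a.vertex m) else idem _ ⟨i, h⟩

/-- The substitution on paths. -/
noncomputable def substPath (a : Q.Fan j s) (p : Q.double.Path) :
    (Q.contract a).double.PathAlgebra :=
  if p.word = [] then a.substVertex p.src else (p.word.map a.substArrow).prod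

/-- The substitution on closed paths, as a polyvector field on the contracted quiver. Paths that are
not closed vanish as polyvector fields and are sent to zero. -/
noncomputable def substClosed (a : Q.Fan j s) (p : Q.double.Path) : (Q.contract a).Polyvector :=
  if p.tgt = p.src then (Q.contract a).toPolyvector (a.substPath p) else 0

end Fan

section Homogeneous

variable {V E : Type*} {Q : ArrowQuiver V E}

theorem ofPath_mem_homogeneous (p : Q.double.Path) : ofPath p ∈ Q.homogeneous (dualCount p.word) :=
  Submodule.subset_span ⟨p, rfl, rfl⟩

theorem idem_mem_homogeneous (i : V) : idem Q.double i ∈ Q.homogeneous 0 :=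
  ofPath_mem_homogeneous (Path.trivial Q.double i)

theorem arrow_mem_homogeneous (x : E ⊕ E) : arrow Q.double x ∈ Q.homogeneous (dualCount [x]) :=
  ofPath_mem_homogeneous (Path.ofArrow Q.double x)

theorem one_mem_homogeneous [Fintype V] : (1 : Q.double.PathAlgebra) ∈ Q.homogeneous 0 :=
  sum_mem fun i _ => idem_mem_homogeneous i

variable [DecidableEq V] [Fintype V]

theorem mul_mem_homogeneous {x y : Q.double.PathAlgebra} {r t : ℕ} (hx : x ∈ Q.homogeneous r)
    (hy : y ∈ Q.homogeneous t) : x * y ∈ Q.homogeneous (r + t) := by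
  induction hx using Submodule.span_induction with
  | zero => simp
  | add x x' _ _ hx hx' => rw [add_mul]; exact add_mem hx hx'
  | smul c x _ hx => rw [smul_mul_eq]; exact Submodule.smul_mem _ _ hx
  | mem x hx =>
    obtain ⟨p, rfl, rfl⟩ := hx
    induction hy using Submodule.span_induction with
    | zero => simp
    | add x y _ _ hx hy => rw [mul_add]; exact add_mem hx hy
    | smul c x _ hx => rw [mul_smul_eq]; exact Submodule.smul_mem _ _ hx
    | mem y hy =>
      obtain ⟨q, rfl, rfl⟩ := hy
      rw [ofPath_mul_ofPath]
      split_ifs with h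
      · rw [← dualCount_append]
        exact ofPath_mem_homogeneous (p.comp q h)
      · exact zero_mem _

theorem toPolyvector_mul_comm {x y : Q.double.PathAlgebra} {r t : ℕ} (hx : x ∈ Q.homogeneous r)
    (hy : y ∈ Q.homogeneous t) :
    Q.toPolyvector (x * y) = (-1 : ℂ) ^ (r * t) • Q.toPolyvector (y * x) := by
  rw [← map_smul, ← sub_eq_zero, ← map_sub]
  exact (Submodule.Quotient.mk_eq_zero _).2 (Submodule.subset_span ⟨r, t, x, y, hx, hy, rfl⟩)

end Homogeneous

namespace Fan

variable [DecidableEq V] [Fintype V] [Fintype E]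

theorem split_mem (a : Q.Fan j s) (b : E) : a.split b ∈ (Q.contract a).homogeneous 0 :=
  sum_mem fun c _ => arrow_mem_homogeneous (Sum.inl c)

theorem splitDual_mem (a : Q.Fan j s) (b : E) : a.splitDual b ∈ (Q.contract a).homogeneous 1 :=
  sum_mem fun c _ => arrow_mem_homogeneous (Sum.inr c)

theorem dualValue_mem (a : Q.Fan j s) (m : Fin s) :
    a.dualValue m ∈ (Q.contract a).homogeneous 1 := by
  rw [← zero_add 1]
  refine Submodule.sub_mem _ ?_ ?_
  · refine mul_mem_homogeneous (idem_mem_homogeneous _) (Submodule.sum_mem _ fun b _ => ?_)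
    exact mul_mem_homogeneous (r := 1) (t := 0) (a.splitDual_mem b) (a.split_mem b)
  · refine mul_mem_homogeneous (idem_mem_homogeneous _) (Submodule.sum_mem _ fun b _ => ?_)
    exact mul_mem_homogeneous (r := 0) (t := 1) (a.split_mem b) (a.splitDual_mem b)

theorem substArrow_mem (a : Q.Fan j s) (x : E ⊕ E) :
    a.substArrow x ∈ (Q.contract a).homogeneous (dualCount [x]) := by
  cases x with
  | inl b =>
    simp only [substArrow]
    split_ifs
    · exact idem_mem_homogeneous _
    · exact a.split_mem b
  | inr b =>
    simp only [substArrow]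
    split_ifs
    · exact a.dualValue_mem _
    · exact a.splitDual_mem b

theorem prod_substArrow_mem (a : Q.Fan j s) (w : List (E ⊕ E)) :
    (w.map a.substArrow).prod ∈ (Q.contract a).homogeneous (dualCount w) := by
  induction w with
  | nil => exact one_mem_homogeneous
  | cons x w ih =>
    rw [List.map_cons, List.prod_cons, ← List.singleton_append, dualCount_append]
    exact mul_mem_homogeneous (a.substArrow_mem x) ih

theorem substPath_cons (a : Q.Fan j s) {p : Q.double.Path} (h : p.word ≠ []) :
    a.substPath p = (p.word.map a.substArrow).prod :=
  if_neg h

theorem substClosed_closed (a : Q.Fan j s) {p : Q.double.Path} (h : p.tgt = p.src) :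
    a.substClosed p = (Q.contract a).toPolyvector (a.substPath p) :=
  if_pos h

theorem substClosed_of_ne (a : Q.Fan j s) {p : Q.double.Path} (h : p.tgt ≠ p.src) :
    a.substClosed p = 0 :=
  if_neg h

theorem substClosed_comp (a : Q.Fan j s) (p r : Q.double.Path) (h1 : p.src = r.tgt)
    (h2 : r.src = p.tgt) :
    a.substClosed (p.comp r h1) =
      (-1 : ℂ) ^ (dualCount p.word * dualCount r.word) • a.substClosed (r.comp p h2) := by
  by_cases e1 : p.word = []
  · have : p.comp r h1 = r.comp p h2 := by
      have hp := p.isWalk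
      rw [e1] at hp
      have hp' : p.tgt = p.src := hp
      ext1
      · exact hp'.trans h1
      · simp [Path.comp, e1]
      · exact h2.trans hp'
    simp [this, e1, dualCount]
  by_cases e2 : r.word = []
  · have : p.comp r h1 = r.comp p h2 := by
      have hr := r.isWalk
      rw [e2] at hr
      have hr' : r.tgt = r.src := hr
      ext1
      · exact (hr'.trans h2).symm
      · simp [Path.comp, e2]
      · exact (h1.trans hr').symm
    simp [this, e2, dualCount]
  have k1 : (p.comp r h1).word ≠ [] := by simp [Path.comp, e1]
  have k2 : (r.comp p h2).word ≠ [] := by simp [Path.comp, e1]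
  rw [a.substClosed_closed (p := p.comp r h1) h2.symm,
    a.substClosed_closed (p := r.comp p h2) h1.symm, a.substPath_cons k1, a.substPath_cons k2]
  simp only [Path.comp, List.map_append, List.prod_append]
  exact toPolyvector_mul_comm (a.prod_substArrow_mem p.word) (a.prod_substArrow_mem r.word)

/-- The substitution on polyvector fields. -/
noncomputable def subst (a : Q.Fan j s) : Q.Polyvector →ₗ[ℂ] (Q.contract a).Polyvector :=
  Q.superCommutators.liftQ (lift a.substClosed) <| by
    refine superCommutators_le_ker _ fun p r => ?_
    rw [ofPath_mul_ofPath, ofPath_mul_ofPath]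
    by_cases h1 : p.src = r.tgt <;> by_cases h2 : r.src = p.tgt
    · rw [dif_pos h1, dif_pos h2, lift_ofPath, lift_ofPath]
      exact a.substClosed_comp p r h1 h2
    · rw [dif_pos h1, dif_neg h2, lift_ofPath,
        a.substClosed_of_ne (p := p.comp r h1) (Ne.symm h2), map_zero, smul_zero]
    · rw [dif_neg h1, dif_pos h2, lift_ofPath,
        a.substClosed_of_ne (p := r.comp p h2) (Ne.symm h1), map_zero, smul_zero]
    · rw [dif_neg h1, dif_neg h2, map_zero, smul_zero]

end Fan

end ArrowQuiver

/-!
The substitution preserves the Schouten bracket in all degrees. It is compatible with products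
of composable elements of the path algebra, so the derivatives of a substituted polyvector field
`γ'` follow from a chain rule. Since `a_m` becomes a trivial path and `a_m*` becomes `e_{v_m} μ` for
one quadratic element `μ`, the derivatives of `γ'` by all `c_{b,i}` (resp. all `c_{b,i}*`) are the
corners of a single element: the image of `D_b γ` (resp. `D_{b*} γ`) plus a term containing
`F = ∑ m, D_{a_m*} γ`. Hence the first half of the bracket of `γ'` and `δ'` is a sum over the
remaining arrows `b`.

On the other side, the bracket of `γ` and `δ` contains the products `D_{a_m*} γ · D_{a_m} δ`. The
supercommutators `[w, D_w δ]` over all arrows `w` at the vertex `j` add up to zero, because each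
cyclic rotation of a closed path occurs once with each sign, and this expresses the `D_{a_m} δ`
through the remaining arrows. Up to cyclic rotation, the two sums then differ by terms which are
supersymmetric in `γ` and `δ`, and these cancel in the bracket.
-/

namespace ArrowQuiver

open PathAlgebra

section Double

variable {V E : Type*} (Q : ArrowQuiver V E) (b : E)

@[simp] theorem double_head_inl : Q.double.head (.inl b) = Q.head b := rfl

@[simp] theorem double_head_inr : Q.double.head (.inr b) = Q.tail b := rfl

@[simp] theorem double_tail_inl : Q.double.tail (.inl b) = Q.tail b := rfl

@[simp] theorem double_tail_inr : Q.double.tail (.inr b) = Q.head b := rfl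

@[simp] theorem dualCount_inl : dualCount [(.inl b : E ⊕ E)] = 0 := rfl

@[simp] theorem dualCount_inr : dualCount [(.inr b : E ⊕ E)] = 1 := rfl

end Double

section Paths

variable {V E : Type*} {Q : ArrowQuiver V E}

/-- The path `x p`, which follows first `p` and then the arrow `x`. -/
@[simps]
def Path.cons (x : E) (p : Q.Path) (h : Q.tail x = p.tgt) : Q.Path :=
  ⟨Q.head x, x :: p.word, p.src, rfl, h ▸ p.isWalk⟩

theorem Path.induction_cons {P : Q.Path → Prop} (trivial : ∀ i, P (Path.trivial Q i))
    (cons : ∀ x p h, P p → P (Path.cons x p h)) (p : Q.Path) : P p := by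
  obtain ⟨t, w, s, hw⟩ := p
  induction w generalizing t with
  | nil =>
    obtain rfl := hw
    exact trivial t
  | cons x w ih =>
    obtain ⟨rfl, hw⟩ := hw
    exact cons x ⟨_, w, s, hw⟩ rfl (ih _ hw)

theorem ofPath_trivial (i : V) : ofPath (Path.trivial Q i) = idem Q i := rfl

variable [DecidableEq V]

theorem ofPath_comp (p q : Q.Path) (h : p.src = q.tgt) :
    ofPath (p.comp q h) = ofPath p * ofPath q :=
  ((ofPath_mul_ofPath p q).trans (dif_pos h)).symm

theorem ofPath_mul_ofPath_of_ne {p q : Q.Path} (h : p.src ≠ q.tgt) : ofPath p * ofPath q = 0 :=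
  (ofPath_mul_ofPath p q).trans (dif_neg h)

theorem ofPath_cons (x : E) (p : Q.Path) (h : Q.tail x = p.tgt) :
    ofPath (p.cons x h) = arrow Q x * ofPath p :=
  ofPath_comp (Path.ofArrow Q x) p h

theorem idem_mul_ofPath (p : Q.Path) : idem Q p.tgt * ofPath p = ofPath p :=
  (trivial_mul p.tgt p).trans (if_pos rfl)

theorem ofPath_mul_idem (p : Q.Path) : ofPath p * idem Q p.src = ofPath p :=
  (mul_trivial p.src p).trans (if_pos rfl)

theorem idem_mul_idem_self (i : V) : idem Q i * idem Q i = idem Q i :=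
  idem_mul_ofPath (Path.trivial Q i)

theorem idem_mul_idem_of_ne {i k : V} (h : i ≠ k) : idem Q i * idem Q k = 0 :=
  ofPath_mul_ofPath_of_ne (p := Path.trivial Q i) (q := Path.trivial Q k) h

theorem idem_mul_arrow (x : E) : idem Q (Q.head x) * arrow Q x = arrow Q x :=
  idem_mul_ofPath (Path.ofArrow Q x)

theorem arrow_mul_idem (x : E) : arrow Q x * idem Q (Q.tail x) = arrow Q x :=
  ofPath_mul_idem (Path.ofArrow Q x)

variable [Fintype V]

noncomputable instance : Algebra ℂ Q.PathAlgebra := Algebra.ofModule smul_mul_eq mul_smul_eq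

theorem ofPath_eq_idem_mul_prod (p : Q.Path) :
    ofPath p = idem Q p.tgt * (p.word.map (arrow Q)).prod := by
  induction p using Path.induction_cons with
  | trivial i => exact (mul_one _).symm
  | cons x p h ih =>
    rw [ofPath_cons, ih, ← h, ← mul_assoc, arrow_mul_idem, Path.cons_tgt, Path.cons_word,
      List.map_cons, List.prod_cons, ← mul_assoc, idem_mul_arrow]

end Paths

section Realization

variable {V E A : Type*}

/-- Elements of a ring representing the vertices and arrows of a quiver, so that the arrows and
their ends multiply as in the path algebra. The idempotents representing different vertices need
not be orthogonal, hence evaluation on the path algebra is multiplicative only on products that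
meet at a vertex, see `Realization.eval_mul`. -/
structure Realization (Q : ArrowQuiver V E) (A : Type*) [Ring A] where
  onVertex : V → A
  onArrow : E → A
  vertex_mul_self : ∀ i, onVertex i * onVertex i = onVertex i
  head_mul_arrow : ∀ x, onVertex (Q.head x) * onArrow x = onArrow x
  arrow_mul_tail : ∀ x, onArrow x * onVertex (Q.tail x) = onArrow x

namespace Realization

variable {Q : ArrowQuiver V E} [Ring A] [Algebra ℂ A] (φ : Q.Realization A)

/-- The linear extension of a realization to the path algebra. -/
noncomputable def eval : Q.PathAlgebra →ₗ[ℂ] A :=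
  lift fun p => φ.onVertex p.tgt * (p.word.map φ.onArrow).prod

theorem eval_ofPath (p : Q.Path) :
    φ.eval (ofPath p) = φ.onVertex p.tgt * (p.word.map φ.onArrow).prod :=
  lift_ofPath _ p

theorem eval_idem (i : V) : φ.eval (idem Q i) = φ.onVertex i :=
  (φ.eval_ofPath _).trans (mul_one _)

theorem eval_arrow (x : E) : φ.eval (arrow Q x) = φ.onArrow x := by
  refine (φ.eval_ofPath _).trans ?_
  simp only [Path.ofArrow, List.map_cons, List.map_nil, List.prod_singleton, φ.head_mul_arrow]

theorem eval_cons (x : E) (p : Q.Path) (h : Q.tail x = p.tgt) :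
    φ.eval (ofPath (p.cons x h)) = φ.onArrow x * φ.eval (ofPath p) := by
  rw [eval_ofPath, eval_ofPath, ← h, ← mul_assoc, φ.arrow_mul_tail, Path.cons_tgt, Path.cons_word,
    List.map_cons, List.prod_cons, ← mul_assoc, φ.head_mul_arrow]

theorem vertex_mul_eval_ofPath (p : Q.Path) :
    φ.onVertex p.tgt * φ.eval (ofPath p) = φ.eval (ofPath p) := by
  rw [eval_ofPath, ← mul_assoc, φ.vertex_mul_self]

variable [DecidableEq V] [Fintype V]

theorem eval_ofPath_mul_ofPath (p q : Q.Path) (h : p.src = q.tgt) :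
    φ.eval (ofPath p * ofPath q) = φ.eval (ofPath p) * φ.eval (ofPath q) := by
  induction p using Path.induction_cons with
  | trivial i =>
    obtain rfl : i = q.tgt := h
    rw [ofPath_trivial, idem_mul_ofPath, eval_idem, vertex_mul_eval_ofPath]
  | cons x p h' ih =>
    replace h : p.src = q.tgt := h
    have hx : Q.tail x = (p.comp q h).tgt := h'
    rw [ofPath_cons, mul_assoc, ← ofPath_comp p q h, ← ofPath_cons x _ hx, eval_cons, ofPath_comp,
      ih h, ← ofPath_cons x p h', eval_cons, mul_assoc]

theorem eval_mul {x y : Q.PathAlgebra} {k : V} (hx : x * idem Q k = x) (hy : idem Q k * y = y) :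
    φ.eval (x * y) = φ.eval x * φ.eval y := by
  have key : ((LinearMap.mul ℂ _).compl₁₂ (LinearMap.mulRight ℂ (idem Q k))
        (LinearMap.mulLeft ℂ (idem Q k))).compr₂ φ.eval =
      (LinearMap.mul ℂ A).compl₁₂ (φ.eval ∘ₗ LinearMap.mulRight ℂ (idem Q k))
        (φ.eval ∘ₗ LinearMap.mulLeft ℂ (idem Q k)) := by
    refine hom_ext fun p => hom_ext fun q => ?_
    change φ.eval (ofPath p * idem Q k * (idem Q k * ofPath q)) =
      φ.eval (ofPath p * idem Q k) * φ.eval (idem Q k * ofPath q)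
    simp only [idem, mul_trivial, trivial_mul]
    split_ifs with hp hq
    · exact φ.eval_ofPath_mul_ofPath p q (hp.symm.trans hq)
    all_goals simp only [mul_zero, zero_mul, map_zero]
  have := LinearMap.congr_fun₂ key x y
  simpa [hx, hy] using this

end Realization

end Realization

section Parity

variable {V E : Type*} {Q : ArrowQuiver V E}

/-- The span of the paths whose number of dual arrows is congruent to `n` modulo two; signs only
depend on this parity, and it avoids the truncated degree `r - 1`. -/
noncomputable def parityPart (Q : ArrowQuiver V E) (n : ℕ) : Submodule ℂ Q.double.PathAlgebra :=
  Submodule.span ℂ {x | ∃ p : Q.double.Path, dualCount p.word ≡ n [MOD 2] ∧ x = ofPath p}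

theorem parityPart_congr {m n : ℕ} (h : m ≡ n [MOD 2]) : Q.parityPart m = Q.parityPart n := by
  unfold parityPart
  congr 1
  ext x
  exact exists_congr fun p => and_congr_left' ⟨fun hp => hp.trans h, fun hp => hp.trans h.symm⟩

theorem homogeneous_le_parityPart (n : ℕ) : Q.homogeneous n ≤ Q.parityPart n :=
  Submodule.span_mono fun _ ⟨p, hp, hx⟩ => ⟨p, congrArg (· % 2) hp, hx⟩

theorem iSup_homogeneous : ⨆ n, Q.homogeneous n = ⊤ := by
  refine eq_top_iff.2 fun x _ => ?_
  induction x using PathAlgebra.induction_on with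
  | h0 => exact zero_mem _
  | hadd x y hx hy => exact add_mem (hx trivial) (hy trivial)
  | hsmul c p =>
    exact Submodule.smul_mem _ c (Submodule.mem_iSup_of_mem _ (ofPath_mem_homogeneous p))

variable [DecidableEq V] [Fintype V]

theorem mul_mem_parityPart {x y : Q.double.PathAlgebra} {m n : ℕ} (hx : x ∈ Q.parityPart m)
    (hy : y ∈ Q.parityPart n) : x * y ∈ Q.parityPart (m + n) := by
  refine (?_ : Q.parityPart m * Q.parityPart n ≤ _) (Submodule.mul_mem_mul hx hy)
  rw [parityPart, parityPart, Submodule.span_mul_span, Submodule.span_le, Set.mul_subset_iff]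
  rintro _ ⟨p, hp, rfl⟩ _ ⟨q, hq, rfl⟩
  rw [← parityPart_congr (hp.add hq)]
  exact homogeneous_le_parityPart _
    (mul_mem_homogeneous (ofPath_mem_homogeneous p) (ofPath_mem_homogeneous q))

theorem toPolyvector_mul_comm_of_parity {x y : Q.double.PathAlgebra} {m n : ℕ}
    (hx : x ∈ Q.parityPart m) (hy : y ∈ Q.parityPart n) :
    Q.toPolyvector (x * y) = (-1 : ℂ) ^ (m * n) • Q.toPolyvector (y * x) := by
  induction hx, hy using Submodule.span_induction₂ with
  | mem_mem x y hx hy =>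
    obtain ⟨p, hp, rfl⟩ := hx
    obtain ⟨q, hq, rfl⟩ := hy
    rw [toPolyvector_mul_comm (ofPath_mem_homogeneous p) (ofPath_mem_homogeneous q),
      neg_one_pow_eq_pow_mod_two, hp.mul hq, ← neg_one_pow_eq_pow_mod_two]
  | zero_left y _ => simp
  | zero_right x _ => simp
  | add_left x y z _ _ _ hx hy => rw [add_mul, mul_add, map_add, map_add, hx, hy, smul_add]
  | add_right x y z _ _ _ hx hy => rw [add_mul, mul_add, map_add, map_add, hx, hy, smul_add]
  | smul_left c x y _ _ h => rw [smul_mul_assoc, mul_smul_comm, map_smul, map_smul, h, smul_comm]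
  | smul_right c x y _ _ h => rw [smul_mul_assoc, mul_smul_comm, map_smul, map_smul, h, smul_comm]

theorem toPolyvector_mul_comm_of_even {x : Q.double.PathAlgebra} (hx : x ∈ Q.homogeneous 0)
    (y : Q.double.PathAlgebra) : Q.toPolyvector (x * y) = Q.toPolyvector (y * x) := by
  have hy : y ∈ ⨆ n, Q.homogeneous n := iSup_homogeneous.symm ▸ Submodule.mem_top
  induction hy using Submodule.iSup_induction' with
  | mem n y hy => rw [toPolyvector_mul_comm hx hy, zero_mul, pow_zero, one_smul]
  | zero => rw [mul_zero, zero_mul]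
  | add y z _ _ hy hz => rw [mul_add, add_mul, map_add, map_add, hy, hz]

end Parity

section InsertDeriv

variable {V E : Type*} [DecidableEq V] [Fintype V] {Q : ArrowQuiver V E}

theorem idem_mul_prod_mul_idem {t i : V} {l : List E} (h : Q.IsWalk t l i) :
    idem Q t * (l.map (arrow Q)).prod * idem Q i = idem Q t * (l.map (arrow Q)).prod := by
  have hp := ofPath_mul_idem (⟨t, l, i, h⟩ : Q.Path)
  rwa [ofPath_eq_idem_mul_prod] at hp

variable {ε : ℂ} {w : E ⊕ E}

open Classical in
/-- The sum of `ε ^ |v| v z u` over all factorizations `u w v` of a word, where `|v|` is the number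
of dual arrows in `v`. -/
noncomputable def insertDerivWord (Q : ArrowQuiver V E) (ε : ℂ) (w : E ⊕ E) :
    List (E ⊕ E) → Q.double.PathAlgebra →ₗ[ℂ] Q.double.PathAlgebra
  | [] => 0
  | x :: l =>
    (if x = w then ε ^ dualCount l • LinearMap.mulLeft ℂ
      (idem Q.double (Q.double.tail w) * (l.map (arrow Q.double)).prod) else 0) +
    Q.insertDerivWord ε w l ∘ₗ LinearMap.mulRight ℂ (arrow Q.double x)

open Classical in
theorem insertDerivWord_cons (x : E ⊕ E) (l : List (E ⊕ E)) (z : Q.double.PathAlgebra) :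
    Q.insertDerivWord ε w (x :: l) z =
      (if x = w then ε ^ dualCount l •
        (idem Q.double (Q.double.tail w) * (l.map (arrow Q.double)).prod * z) else 0) +
      Q.insertDerivWord ε w l (z * arrow Q.double x) := by
  rw [insertDerivWord]
  split_ifs <;> rfl

theorem insertDerivWord_append (u v : List (E ⊕ E)) (z : Q.double.PathAlgebra) :
    Q.insertDerivWord ε w (u ++ v) z =
      ε ^ dualCount v • Q.insertDerivWord ε w u ((v.map (arrow Q.double)).prod * z) +
        Q.insertDerivWord ε w v (z * (u.map (arrow Q.double)).prod) := by
  induction u generalizing z with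
  | nil => simp [insertDerivWord]
  | cons x u ih =>
    rw [List.cons_append, insertDerivWord_cons, ih, insertDerivWord_cons, List.map_cons,
      List.prod_cons, dualCount_append, List.map_append, List.prod_append, pow_add, smul_add]
    split_ifs <;> simp only [mul_assoc, mul_smul, smul_zero, zero_add, add_assoc,
      smul_comm (ε ^ dualCount v)]

theorem insertDerivWord_idem_mul {t i : V} {l : List (E ⊕ E)} (h : Q.double.IsWalk t l i)
    (z : Q.double.PathAlgebra) :
    Q.insertDerivWord ε w l (idem Q.double i * z) = Q.insertDerivWord ε w l z := by
  induction l generalizing t z with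
  | nil => rfl
  | cons x l ih =>
    rw [insertDerivWord_cons, insertDerivWord_cons, mul_assoc (idem _ i), ih h.2]
    split_ifs with hx
    · obtain rfl := hx
      rw [← mul_assoc, idem_mul_prod_mul_idem h.2]
    · rfl

/-- The superderivative with an element inserted: `insertDeriv ε w` sends a path `p` and `z` to the
sum of `ε ^ |v| v z u` over all factorizations `p = u w v`. For `p` closed of degree `r`,
`ε = (-1) ^ (r + 1)` and `z = 1` this is `D_w p`. In contrast to `D_w` it is defined before passing
to polyvector fields, and it obeys a Leibniz rule, see `insertDeriv_mul`. -/
noncomputable def insertDeriv (Q : ArrowQuiver V E) (ε : ℂ) (w : E ⊕ E) :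
    Q.double.PathAlgebra →ₗ[ℂ] Q.double.PathAlgebra →ₗ[ℂ] Q.double.PathAlgebra :=
  lift fun p => Q.insertDerivWord ε w p.word ∘ₗ LinearMap.mulRight ℂ (idem Q.double p.tgt)

theorem insertDeriv_ofPath (p : Q.double.Path) (z : Q.double.PathAlgebra) :
    Q.insertDeriv ε w (ofPath p) z = Q.insertDerivWord ε w p.word (z * idem Q.double p.tgt) := by
  rw [insertDeriv, lift_ofPath]
  rfl

theorem insertDeriv_idem (i : V) : Q.insertDeriv ε w (idem Q.double i) = 0 :=
  LinearMap.ext fun z => insertDeriv_ofPath (Path.trivial Q.double i) z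

open Classical in
theorem insertDeriv_arrow (x : E ⊕ E) (z : Q.double.PathAlgebra) :
    Q.insertDeriv ε w (arrow Q.double x) z =
      if x = w then idem _ (Q.double.tail w) * z * idem _ (Q.double.head w) else 0 := by
  refine (insertDeriv_ofPath (Path.ofArrow Q.double x) z).trans ?_
  refine (insertDerivWord_cons _ _ _).trans ?_
  split_ifs with h
  · obtain rfl := h
    simp [dualCount, insertDerivWord, mul_assoc, Path.ofArrow]
  · exact add_zero _

theorem insertDeriv_idem_mul (p : Q.double.Path) (z : Q.double.PathAlgebra) :
    Q.insertDeriv ε w (ofPath p) (idem Q.double p.src * z) = Q.insertDeriv ε w (ofPath p) z := by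
  rw [insertDeriv_ofPath, insertDeriv_ofPath, mul_assoc, insertDerivWord_idem_mul p.isWalk]

theorem insertDeriv_mul_idem (p : Q.double.Path) (z : Q.double.PathAlgebra) :
    Q.insertDeriv ε w (ofPath p) (z * idem Q.double p.tgt) = Q.insertDeriv ε w (ofPath p) z := by
  rw [insertDeriv_ofPath, insertDeriv_ofPath, mul_assoc, idem_mul_idem_self]

theorem insertDeriv_ofPath_mul_ofPath (p q : Q.double.Path) (z : Q.double.PathAlgebra) :
    Q.insertDeriv ε w (ofPath p * ofPath q) z =
      ε ^ dualCount q.word • Q.insertDeriv ε w (ofPath p) (ofPath q * z) +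
        Q.insertDeriv ε w (ofPath q) (z * ofPath p) := by
  by_cases h : p.src = q.tgt
  · rw [← ofPath_comp p q h, insertDeriv_ofPath]
    change Q.insertDerivWord ε w (p.word ++ q.word) (z * idem _ p.tgt) = _
    have hp : ofPath p * idem _ q.tgt = idem _ p.tgt * (p.word.map (arrow Q.double)).prod := by
      rw [← h, ofPath_mul_idem, ofPath_eq_idem_mul_prod]
    rw [insertDerivWord_append, ← insertDerivWord_idem_mul p.isWalk, h, insertDeriv_ofPath,
      insertDeriv_ofPath, ofPath_eq_idem_mul_prod q]
    simp only [mul_assoc, hp]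
  · rw [ofPath_mul_ofPath_of_ne h, ← insertDeriv_idem_mul p, ← insertDeriv_mul_idem q, ← mul_assoc,
      mul_assoc z]
    simp only [idem, ofPath_mul_ofPath_of_ne (p := Path.trivial Q.double p.src) h,
      ofPath_mul_ofPath_of_ne (q := Path.trivial Q.double q.tgt) h]
    simp

theorem insertDeriv_mul (x : Q.double.PathAlgebra) {y : Q.double.PathAlgebra} {n : ℕ}
    (hy : y ∈ Q.homogeneous n) (z : Q.double.PathAlgebra) :
    Q.insertDeriv ε w (x * y) z =
      ε ^ n • Q.insertDeriv ε w x (y * z) + Q.insertDeriv ε w y (z * x) := by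
  induction hy using Submodule.span_induction with
  | zero => simp
  | add y y' _ _ hy hy' =>
    simp only [mul_add, add_mul, map_add, LinearMap.add_apply, hy, hy', smul_add]
    abel
  | smul c y _ hy =>
    simp only [mul_smul_comm, smul_mul_assoc, map_smul, LinearMap.smul_apply, hy, smul_add,
      smul_comm c]
  | mem y hy =>
    obtain ⟨q, rfl, rfl⟩ := hy
    induction x using PathAlgebra.induction_on with
    | h0 => simp
    | hadd x x' hx hx' =>
      simp only [mul_add, add_mul, map_add, LinearMap.add_apply, hx, hx', smul_add]
      abel
    | hsmul c p =>
      simp only [mul_smul_comm, smul_mul_assoc, map_smul, LinearMap.smul_apply,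
        insertDeriv_ofPath_mul_ofPath, smul_add, smul_comm c]

theorem insertDeriv_cons (x : E ⊕ E) (p : Q.double.Path) (h : Q.double.tail x = p.tgt)
    (z : Q.double.PathAlgebra) :
    Q.insertDeriv ε w (ofPath (p.cons x h)) z =
      ε ^ dualCount p.word • Q.insertDeriv ε w (arrow Q.double x) (ofPath p * z) +
        Q.insertDeriv ε w (ofPath p) (z * arrow Q.double x) := by
  rw [ofPath_cons, insertDeriv_mul _ (ofPath_mem_homogeneous p)]

theorem idem_mul_insertDeriv (x z : Q.double.PathAlgebra) :
    idem Q.double (Q.double.tail w) * Q.insertDeriv ε w x z = Q.insertDeriv ε w x z := by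
  induction x using PathAlgebra.induction_on with
  | h0 => simp
  | hadd x y hx hy => rw [map_add, LinearMap.add_apply, mul_add, hx, hy]
  | hsmul c p =>
    rw [map_smul, LinearMap.smul_apply, mul_smul_comm]
    congr 1
    induction p using Path.induction_cons generalizing z with
    | trivial i => simp [ofPath_trivial, insertDeriv_idem]
    | cons x p h ih =>
      rw [insertDeriv_cons, mul_add, mul_smul_comm, ih, insertDeriv_arrow]
      split_ifs
      · simp only [← mul_assoc, idem_mul_idem_self]
      · rw [mul_zero]

theorem insertDeriv_mul_idem_head (x z : Q.double.PathAlgebra) :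
    Q.insertDeriv ε w x z * idem Q.double (Q.double.head w) = Q.insertDeriv ε w x z := by
  induction x using PathAlgebra.induction_on with
  | h0 => simp
  | hadd x y hx hy => rw [map_add, LinearMap.add_apply, add_mul, hx, hy]
  | hsmul c p =>
    rw [map_smul, LinearMap.smul_apply, smul_mul_assoc]
    congr 1
    induction p using Path.induction_cons generalizing z with
    | trivial i => simp [ofPath_trivial, insertDeriv_idem]
    | cons x p h ih =>
      rw [insertDeriv_cons, add_mul, smul_mul_assoc, ih, insertDeriv_arrow]
      split_ifs
      · simp only [mul_assoc, idem_mul_idem_self]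
      · rw [zero_mul]

theorem insertDeriv_mem_parityPart {x z : Q.double.PathAlgebra} {m n : ℕ}
    (hx : x ∈ Q.homogeneous m) (hz : z ∈ Q.parityPart n) :
    Q.insertDeriv ε w x z ∈ Q.parityPart (m + dualCount [w] + n) := by
  induction hx using Submodule.span_induction with
  | zero => simp
  | add x y _ _ hx hy => simpa using add_mem hx hy
  | smul c x _ hx => simpa using Submodule.smul_mem _ c hx
  | mem x hx =>
    obtain ⟨p, rfl, rfl⟩ := hx
    induction p using Path.induction_cons generalizing z n with
    | trivial i => simp [ofPath_trivial, insertDeriv_idem]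
    | cons x p h ih =>
      have hidem (i : V) : idem Q.double i ∈ Q.parityPart 0 :=
        homogeneous_le_parityPart _ (idem_mem_homogeneous i)
      have hcount : dualCount (p.cons x h).word = dualCount [x] + dualCount p.word :=
        dualCount_append [x] p.word
      rw [insertDeriv_cons, insertDeriv_arrow, hcount]
      refine add_mem (Submodule.smul_mem _ _ ?_) ?_
      · split_ifs with hw
        · obtain rfl := hw
          have hpz := mul_mem_parityPart
            (homogeneous_le_parityPart _ (ofPath_mem_homogeneous p)) hz
          refine parityPart_congr ?_ ▸
            mul_mem_parityPart (mul_mem_parityPart (hidem _) hpz) (hidem _)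
          simp only [Nat.ModEq]
          omega
        · exact zero_mem _
      · convert ih (mul_mem_parityPart hz
          (homogeneous_le_parityPart _ (arrow_mem_homogeneous x))) using 2
        ring

end InsertDeriv

section SuperDeriv

variable {V E : Type*} [DecidableEq V] [Fintype V] {Q : ArrowQuiver V E} (w : E ⊕ E)

open Classical in
theorem insertDerivWord_eq_sum (ε : ℂ) (l : List (E ⊕ E)) (z : Q.double.PathAlgebra) :
    Q.insertDerivWord ε w l z = ∑ i ∈ Finset.range l.length,
      if l[i]? = some w then ε ^ dualCount (l.drop (i + 1)) •
        (idem Q.double (Q.double.tail w) * ((l.drop (i + 1)).map (arrow Q.double)).prod * z *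
          ((l.take i).map (arrow Q.double)).prod) else 0 := by
  induction l generalizing z with
  | nil => rfl
  | cons x l ih =>
    rw [insertDerivWord_cons, List.length_cons, Finset.sum_range_succ', ih, add_comm]
    simp [mul_assoc]

theorem neg_one_pow_mul_eq_pow_succ (m n : ℕ) :
    (-1 : ℂ) ^ (m * n) = ((-1) ^ (m + n + 1)) ^ m := by
  rw [← pow_mul]
  refine neg_one_pow_congr ?_
  simp only [Nat.even_mul, Nat.even_add_one, Nat.even_add]
  tauto

theorem sum_superDerivTerm (l : List (E ⊕ E)) :
    ∑ i ∈ Finset.range l.length, Q.superDerivTerm w l i =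
      Q.insertDerivWord ((-1) ^ (dualCount l + 1)) w l 1 := by
  rw [insertDerivWord_eq_sum]
  refine Finset.sum_congr rfl fun i _ => ?_
  have hcount : dualCount l = dualCount (l.drop (i + 1)) + dualCount (l.take (i + 1)) := by
    rw [add_comm, ← dualCount_append, List.take_append_drop]
  unfold superDerivTerm
  rw [neg_one_pow_mul_eq_pow_succ, ← hcount, mul_one, List.map_append, List.prod_append, mul_assoc]

theorem superDeriv_toPolyvector {x : Q.double.PathAlgebra} {r : ℕ} (hx : x ∈ Q.homogeneous r) :
    Q.superDeriv w (Q.toPolyvector x) = Q.insertDeriv ((-1) ^ (r + 1)) w x 1 := by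
  have hlift : ∀ p, Q.superDeriv w (Q.toPolyvector (ofPath p)) = Q.superDerivPath w p :=
    lift_ofPath _
  refine LinearMap.eqOn_span (f := Q.superDeriv w ∘ₗ Q.toPolyvector)
    (g := (Q.insertDeriv ((-1) ^ (r + 1)) w).flip 1) ?_ hx
  rintro _ ⟨p, rfl, rfl⟩
  rw [LinearMap.comp_apply, LinearMap.flip_apply, hlift, insertDeriv_ofPath,
    ← insertDerivWord_idem_mul p.isWalk, one_mul]
  by_cases h : p.tgt = p.src
  · rw [superDerivPath_closed _ _ h, sum_superDerivTerm, h, idem_mul_idem_self,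
      ← insertDerivWord_idem_mul p.isWalk, mul_one]
  · rw [superDerivPath_of_ne _ _ h, idem_mul_idem_of_ne (Ne.symm h), map_zero]

theorem superDeriv_mem_parityPart {γ : Q.Polyvector} {r : ℕ} (hγ : γ ∈ Q.polyvectorDegree r) :
    Q.superDeriv w γ ∈ Q.parityPart (r + dualCount [w]) := by
  obtain ⟨x, hx, rfl⟩ := hγ
  rw [superDeriv_toPolyvector w hx]
  have hone : (1 : Q.double.PathAlgebra) ∈ Q.parityPart 0 :=
    homogeneous_le_parityPart 0 one_mem_homogeneous
  simpa only [add_zero] using insertDeriv_mem_parityPart (w := w) hx hone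

theorem toPolyvector_ofPath_of_ne {p : Q.double.Path} (h : p.tgt ≠ p.src) :
    Q.toPolyvector (ofPath p) = 0 := by
  rw [← idem_mul_ofPath, toPolyvector_mul_comm_of_even (idem_mem_homogeneous _), ← ofPath_mul_idem,
    mul_assoc, idem_mul_idem_of_ne h.symm, mul_zero, map_zero]

theorem polyvectorDegree_eq_span (r : ℕ) : Q.polyvectorDegree r = Submodule.span ℂ
    {γ | ∃ p : Q.double.Path, p.tgt = p.src ∧ dualCount p.word = r ∧
      γ = Q.toPolyvector (ofPath p)} := by
  rw [polyvectorDegree, homogeneous, Submodule.map_span]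
  refine le_antisymm (Submodule.span_le.2 ?_) (Submodule.span_mono ?_)
  · rintro _ ⟨_, ⟨p, hr, rfl⟩, rfl⟩
    by_cases h : p.tgt = p.src
    · exact Submodule.subset_span ⟨p, h, hr, rfl⟩
    · rw [toPolyvector_ofPath_of_ne h]
      exact zero_mem _
  · rintro _ ⟨p, -, hr, rfl⟩
    exact ⟨_, ⟨p, hr, rfl⟩, rfl⟩

theorem eqOn_polyvectorDegree {M : Type*} [AddCommGroup M] [Module ℂ M]
    {f g : Q.Polyvector →ₗ[ℂ] M} {r : ℕ} (h : ∀ p : Q.double.Path, p.tgt = p.src →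
      dualCount p.word = r → f (Q.toPolyvector (ofPath p)) = g (Q.toPolyvector (ofPath p))) :
    Set.EqOn f g (Q.polyvectorDegree r) := by
  rw [polyvectorDegree_eq_span]
  refine LinearMap.eqOn_span' ?_
  rintro _ ⟨p, hp, hr, rfl⟩
  exact h p hp hr

theorem idem_mul_superDeriv {γ : Q.Polyvector} {r : ℕ} (hγ : γ ∈ Q.polyvectorDegree r) :
    idem Q.double (Q.double.tail w) * Q.superDeriv w γ = Q.superDeriv w γ := by
  obtain ⟨x, hx, rfl⟩ := hγ
  rw [superDeriv_toPolyvector w hx, idem_mul_insertDeriv]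

theorem superDeriv_mul_idem {γ : Q.Polyvector} {r : ℕ} (hγ : γ ∈ Q.polyvectorDegree r) :
    Q.superDeriv w γ * idem Q.double (Q.double.head w) = Q.superDeriv w γ := by
  obtain ⟨x, hx, rfl⟩ := hγ
  rw [superDeriv_toPolyvector w hx, insertDeriv_mul_idem_head]

end SuperDeriv

section Euler

variable {V E : Type*} [DecidableEq V] [Fintype V] [Fintype E] {Q : ArrowQuiver V E}

theorem sum_arrow_mul_insertDeriv_sub (ε : ℂ) (p : Q.double.Path) (z : Q.double.PathAlgebra) :
    ∑ w, (ε ^ dualCount [w] • (arrow Q.double w * Q.insertDeriv ε w (ofPath p) z) -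
        Q.insertDeriv ε w (ofPath p) z * arrow Q.double w) =
      ε ^ dualCount p.word • (ofPath p * z * idem Q.double p.tgt) -
        idem Q.double p.src * z * ofPath p := by
  classical
  induction p using Path.induction_cons generalizing z with
  | trivial i =>
    simp only [ofPath_trivial, insertDeriv_idem]
    simp [Path.trivial, dualCount]
  | cons x p h ih =>
    have hcount : dualCount (p.cons x h).word = dualCount [x] + dualCount p.word :=
      dualCount_append [x] p.word
    have hp : idem Q.double (Q.double.tail x) * ofPath p = ofPath p := h ▸ idem_mul_ofPath p
    have hx : arrow Q.double x * idem Q.double p.tgt = arrow Q.double x := h ▸ arrow_mul_idem x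
    have key : ∑ w, (ε ^ dualCount [w] •
          (arrow Q.double w * Q.insertDeriv ε w (arrow Q.double x) (ofPath p * z)) -
        Q.insertDeriv ε w (arrow Q.double x) (ofPath p * z) * arrow Q.double w) =
      ε ^ dualCount [x] • (arrow Q.double x * ofPath p * z * idem Q.double (Q.double.head x)) -
        ofPath p * z * arrow Q.double x := by
      simp only [insertDeriv_arrow]
      rw [Finset.sum_eq_single x (fun w _ hw => by simp [hw.symm]) (by simp), if_pos rfl]
      simp only [← mul_assoc, hp]
      simp only [mul_assoc, idem_mul_arrow]
    calc _ = ε ^ dualCount p.word • ∑ w, (ε ^ dualCount [w] •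
          (arrow Q.double w * Q.insertDeriv ε w (arrow Q.double x) (ofPath p * z)) -
        Q.insertDeriv ε w (arrow Q.double x) (ofPath p * z) * arrow Q.double w) +
        ∑ w, (ε ^ dualCount [w] •
          (arrow Q.double w * Q.insertDeriv ε w (ofPath p) (z * arrow Q.double x)) -
        Q.insertDeriv ε w (ofPath p) (z * arrow Q.double x) * arrow Q.double w) := by
          simp only [Finset.smul_sum, ← Finset.sum_add_distrib, insertDeriv_cons, mul_add, add_mul,
            smul_add, smul_sub, mul_smul_comm, smul_mul_assoc, smul_comm (ε ^ dualCount p.word)]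
          refine Finset.sum_congr rfl fun w _ => ?_
          abel
      _ = _ := by
          rw [key, ih, hcount, ofPath_cons]
          simp only [Path.cons_tgt, Path.cons_src, mul_assoc, hx, pow_add, mul_smul, smul_sub,
            smul_comm (ε ^ dualCount p.word)]
          abel

theorem sum_arrow_mul_superDeriv_sub {γ : Q.Polyvector} {r : ℕ}
    (hγ : γ ∈ Q.polyvectorDegree r) :
    ∑ w, (((-1 : ℂ) ^ (r + 1)) ^ dualCount [w] • (arrow Q.double w * Q.superDeriv w γ) -
      Q.superDeriv w γ * arrow Q.double w) = 0 := by
  have hsign : ((-1 : ℂ) ^ (r + 1)) ^ r = 1 := by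
    rw [← pow_mul, mul_comm, r.even_mul_succ_self.neg_one_pow]
  have key := eqOn_polyvectorDegree (f := ∑ w, (((-1 : ℂ) ^ (r + 1)) ^ dualCount [w] •
      (LinearMap.mulLeft ℂ (arrow Q.double w) ∘ₗ Q.superDeriv w) -
      LinearMap.mulRight ℂ (arrow Q.double w) ∘ₗ Q.superDeriv w)) (g := 0) (fun p hp hr => ?_) hγ
  · simpa [LinearMap.sum_apply] using key
  · have hx : ofPath p ∈ Q.homogeneous r := hr ▸ ofPath_mem_homogeneous p
    have hE := sum_arrow_mul_insertDeriv_sub ((-1) ^ (r + 1)) p 1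
    rw [hr, hsign, one_smul, mul_one, mul_one, hp, ofPath_mul_idem, ← hp, idem_mul_ofPath,
      sub_self] at hE
    simp only [LinearMap.sum_apply, LinearMap.sub_apply, LinearMap.smul_apply,
      LinearMap.comp_apply, LinearMap.mulLeft_apply, LinearMap.mulRight_apply,
      superDeriv_toPolyvector _ hx, hE, LinearMap.zero_apply]

theorem sum_superDeriv_at_vertex {γ : Q.Polyvector} {r : ℕ} (hγ : γ ∈ Q.polyvectorDegree r)
    (i : V) :
    ∑ b : E, ((if Q.head b = i then arrow Q.double (.inl b) * Q.superDeriv (.inl b) γ -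
        Q.superDeriv (.inr b) γ * arrow Q.double (.inr b) else 0) +
      if Q.tail b = i then (-1 : ℂ) ^ (r + 1) •
        (arrow Q.double (.inr b) * Q.superDeriv (.inr b) γ) -
        Q.superDeriv (.inl b) γ * arrow Q.double (.inl b) else 0) = 0 := by
  have harrow (w : E ⊕ E) : idem Q.double i * arrow Q.double w =
      if Q.double.head w = i then arrow Q.double w else 0 := by
    simp only [eq_comm (b := i)]
    exact trivial_mul i (Path.ofArrow Q.double w)
  have hderiv (w : E ⊕ E) : idem Q.double i * Q.superDeriv w γ =
      if Q.double.tail w = i then Q.superDeriv w γ else 0 := by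
    split_ifs with h
    · rw [← h, idem_mul_superDeriv w hγ]
    · rw [← idem_mul_superDeriv w hγ, ← mul_assoc, idem_mul_idem_of_ne (Ne.symm h), zero_mul]
  have key := congrArg (idem Q.double i * ·) (sum_arrow_mul_superDeriv_sub hγ)
  simp only [mul_zero, Fintype.sum_sum_type, mul_add, Finset.mul_sum, mul_sub, mul_smul_comm,
    ← mul_assoc, harrow, hderiv, ← Finset.sum_add_distrib, double_head_inl, double_head_inr,
    double_tail_inl, double_tail_inr, dualCount_inl, dualCount_inr, pow_zero, pow_one,
    one_smul] at key
  refine Eq.trans (Finset.sum_congr rfl fun b _ => ?_) key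
  by_cases hh : Q.head b = i <;> by_cases ht : Q.tail b = i <;>
    simp only [hh, ht, if_true, if_false, zero_mul, smul_zero] <;> abel

end Euler

section Schouten

variable {V E : Type*} [DecidableEq V] [Fintype V] [Fintype E] {Q : ArrowQuiver V E} {m n : ℕ}

theorem schouten_eq_sub (γ δ : Q.Polyvector) :
    Q.schouten m n γ δ =
      Q.toPolyvector (∑ b, Q.superDeriv (.inr b) γ * Q.superDeriv (.inl b) δ) -
        (-1 : ℂ) ^ ((m + 1) * (n + 1)) •
          Q.toPolyvector (∑ b, Q.superDeriv (.inr b) δ * Q.superDeriv (.inl b) γ) := by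
  have hsign : (-1 : ℂ) ^ (((m : ℤ) - 1) * ((n : ℤ) - 1)) = (-1 : ℂ) ^ ((m + 1) * (n + 1)) := by
    rw [← zpow_natCast, neg_one_zpow_eq_ite, neg_one_zpow_eq_ite]
    simp only [Nat.cast_mul, Nat.cast_add, Nat.cast_one, Int.even_mul, Int.even_sub, Int.even_add]
  rw [schouten, hsign, Finset.sum_sub_distrib, ← Finset.smul_sum, map_sub, map_smul]

end Schouten

section CrossPairing

/-- The combination `u v' x + ε u' x v`. Its class in the space of polyvector fields is
supersymmetric in the pairs `(u, u')` and `(v, v')` when `x` is odd and `ε` is the sign of `v`. -/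
noncomputable def crossPairing {A : Type*} [Ring A] [Algebra ℂ A] (ε : ℂ) (u u' v v' x : A) : A :=
  u * v' * x + ε • (u' * x * v)

theorem mul_eq_add_crossPairing_add_lie {A : Type*} [Ring A] [Algebra ℂ A] (t h : Prop)
    [Decidable t] [Decidable h] (ε : ℂ) (d f e d' f' x y : A) :
    (d + ((if t then x * f else 0) - if h then f * x else 0)) *
        (e + ((if t then f' * y else 0) - if h then ε • (y * f') else 0)) =
      d * e + f * ((if t then e * x - ε • (y * d') + f' * (y * x) else 0) +
        if h then d' * y - x * e - f' * (x * y) else 0) +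
      ((if t then crossPairing ε d f d' f' y else 0) +
        ((if h then crossPairing ε f f f' f' (x * y) - crossPairing ε f d f' d' y else 0) -
          if t ∧ h then crossPairing ε f (x * f) f' (x * f') y else 0)) +
      if t then ⁅x, f * (e + f' * y)⁆ else 0 := by
  simp only [crossPairing, Ring.lie_def]
  by_cases ht : t <;> by_cases hh : h <;>
    simp only [ht, hh, and_self, and_true, and_false, if_true, if_false, add_mul, sub_mul, mul_add,
      mul_sub, mul_smul_comm, mul_assoc, mul_zero, add_zero, zero_add, sub_zero, zero_sub, neg_mul,
      mul_neg] <;> module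

variable {V E : Type*} [DecidableEq V] [Fintype V] {Q : ArrowQuiver V E} {m n : ℕ}
  {u u' v v' x : Q.double.PathAlgebra}

theorem toPolyvector_mul_mul_of_odd (hu : u ∈ Q.parityPart m) (hv : v ∈ Q.parityPart n)
    (hx : x ∈ Q.parityPart 1) :
    Q.toPolyvector (u * v * x) =
      (-1 : ℂ) ^ (m * n) • (-1 : ℂ) ^ m • Q.toPolyvector (v * x * u) := by
  rw [mul_assoc, toPolyvector_mul_comm_of_parity hu (mul_mem_parityPart hv hx), mul_add, mul_one,
    pow_add, mul_smul]

theorem toPolyvector_crossPairing_comm (hu : u ∈ Q.parityPart m) (hu' : u' ∈ Q.parityPart m)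
    (hv : v ∈ Q.parityPart n) (hv' : v' ∈ Q.parityPart n) (hx : x ∈ Q.parityPart 1) :
    Q.toPolyvector (crossPairing ((-1) ^ n) u u' v v' x) =
      (-1 : ℂ) ^ (m * n) • Q.toPolyvector (crossPairing ((-1) ^ m) v v' u u' x) := by
  have hsq (z : Q.Polyvector) : (-1 : ℂ) ^ (m * n) • (-1 : ℂ) ^ (m * n) • z = z := by
    rw [smul_smul, ← pow_add, Even.neg_one_pow ⟨m * n, rfl⟩, one_smul]
  rw [crossPairing, crossPairing, map_add, map_add, map_smul, map_smul,
    toPolyvector_mul_mul_of_odd hu hv' hx, toPolyvector_mul_mul_of_odd hv hu' hx, smul_add,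
    mul_comm n m, hsq, add_comm]

end CrossPairing

namespace Fan

section Fibers

variable {V E : Type*} {Q : ArrowQuiver V E} {j : V} {s : ℕ} (a : Q.Fan j s)

theorem arr_injective : Function.Injective a.arr :=
  fun _ _ h => a.tail_injective (congrArg Q.tail h)

theorem vertex_injective : Function.Injective a.vertex :=
  fun _ _ h => a.tail_injective (congrArg Subtype.val h)

theorem eq_of_base_eq {c d : a.Arrow} (hb : c.base = d.base)
    (hh : (Q.contract a).head c = (Q.contract a).head d)
    (ht : (Q.contract a).tail c = (Q.contract a).tail d) : c = d := by
  cases c <;> cases d <;> simp only [Arrow.base] at hb <;> subst hb <;>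
    first | contradiction | rfl |
      simpa only [contract, a.vertex_injective.eq_iff, Arrow.outgoing.injEq, Arrow.incoming.injEq,
        Arrow.loop.injEq, true_and, and_true] using And.intro hh ht

open Classical in
/-- The vertices of the contracted quiver into which a vertex `i` is decomposed: `i` itself if
`i ≠ j`, and the `v_m` if `i = j`. -/
noncomputable def fiber [Fintype V] (i : V) : Finset {i : V // i ≠ j} :=
  {k | k.1 = i ∨ i = j ∧ k ∈ Set.range a.vertex}

open Classical in
/-- The arrows other than `a₁, …, a_s`. -/
noncomputable def remaining [Fintype E] : Finset E :=
  {b | b ∉ Set.range a.arr}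

section Arrows

variable [Fintype E]

theorem mem_remaining {b : E} : b ∈ a.remaining ↔ b ∉ Set.range a.arr := by
  simp only [remaining, Finset.mem_filter_univ]

theorem base_mem_remaining (c : a.Arrow) : c.base ∈ a.remaining := by
  rw [mem_remaining]
  rintro ⟨m, hm⟩
  have hj : Q.head c.base = j := hm ▸ a.head_arr m
  cases c with
  | keep b hh ht => exact hh hj
  | outgoing b hh ht => exact hh hj
  | incoming b hh ht hb => exact hb ⟨m, hm⟩
  | loop b hh ht => exact a.tail_ne m (hm ▸ ht)

theorem sum_eq_sum_arr_add_sum_remaining {M : Type*} [AddCommMonoid M] (f : E → M) :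
    ∑ b, f b = ∑ m, f (a.arr m) + ∑ b ∈ a.remaining, f b := by
  classical
  rw [← Finset.sum_filter_add_sum_filter_not Finset.univ (· ∈ Set.range a.arr), remaining]
  congr 1
  rw [← Finset.sum_image (s := Finset.univ) a.arr_injective.injOn]
  congr 1
  ext b
  simp

end Arrows

variable [Fintype V]

theorem mem_fiber {i : V} {k : {i : V // i ≠ j}} :
    k ∈ a.fiber i ↔ k.1 = i ∨ i = j ∧ k ∈ Set.range a.vertex := by
  simp only [fiber, Finset.mem_filter_univ]

theorem mem_fiber_self (i : {i : V // i ≠ j}) : i ∈ a.fiber i :=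
  a.mem_fiber.2 (.inl rfl)

theorem vertex_mem_fiber (m : Fin s) : a.vertex m ∈ a.fiber j :=
  a.mem_fiber.2 (.inr ⟨rfl, m, rfl⟩)

theorem head_mem_fiber (c : a.Arrow) : (Q.contract a).head c ∈ a.fiber (Q.head c.base) := by
  cases c with
  | keep b hh ht => exact a.mem_fiber_self ⟨_, hh⟩
  | outgoing b hh ht m => exact a.mem_fiber_self ⟨_, hh⟩
  | incoming b hh ht hb m => exact hh ▸ a.vertex_mem_fiber m
  | loop b hh ht m n => exact hh ▸ a.vertex_mem_fiber m

theorem tail_mem_fiber (c : a.Arrow) : (Q.contract a).tail c ∈ a.fiber (Q.tail c.base) := by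
  cases c with
  | keep b hh ht => exact a.mem_fiber_self ⟨_, ht⟩
  | outgoing b hh ht m => exact ht ▸ a.vertex_mem_fiber m
  | incoming b hh ht hb m => exact a.mem_fiber_self ⟨_, ht⟩
  | loop b hh ht m n => exact ht ▸ a.vertex_mem_fiber n

theorem fiber_eq_singleton (i : {i : V // i ≠ j}) : a.fiber i = {i} := by
  ext k
  simp [mem_fiber, i.2, Subtype.ext_iff]

theorem fiber_eq_image [DecidableEq V] : a.fiber j = Finset.univ.image a.vertex := by
  ext k
  simp [mem_fiber, k.2]

theorem exists_arrow_of_mem_fiber [Fintype E] {b : E} (hb : b ∈ a.remaining)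
    {k l : {i : V // i ≠ j}} (hk : k ∈ a.fiber (Q.head b)) (hl : l ∈ a.fiber (Q.tail b)) :
    ∃ c : a.Arrow, c.base = b ∧ (Q.contract a).head c = k ∧ (Q.contract a).tail c = l := by
  rw [mem_fiber] at hk hl
  obtain ⟨k, hk'⟩ := k
  obtain ⟨l, hl'⟩ := l
  obtain hk | ⟨hh, m, hm⟩ := hk <;> obtain hl | ⟨ht, n, hn⟩ := hl
  · subst hk hl
    exact ⟨.keep b hk' hl', rfl, rfl, rfl⟩
  · subst hk
    exact ⟨.outgoing b hk' ht n, rfl, rfl, hn⟩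
  · subst hl
    exact ⟨.incoming b hh hl' (a.mem_remaining.1 hb) m, rfl, hm, rfl⟩
  · exact ⟨.loop b hh ht m n, rfl, hm, hn⟩

open Classical in
theorem sum_arrow_eq_sum_fiber [Fintype E] {M : Type*} [AddCommMonoid M] {b : E}
    (hb : b ∈ a.remaining) (f : {i : V // i ≠ j} → {i : V // i ≠ j} → M) :
    ∑ c : a.Arrow with c.base = b, f ((Q.contract a).head c) ((Q.contract a).tail c) =
      ∑ k ∈ a.fiber (Q.head b), ∑ l ∈ a.fiber (Q.tail b), f k l := by
  rw [← Finset.sum_product']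
  refine Finset.sum_bij (fun c _ => ((Q.contract a).head c, (Q.contract a).tail c)) ?_ ?_ ?_ ?_
  · intro c hc
    obtain rfl := (Finset.mem_filter.1 hc).2
    exact Finset.mk_mem_product (a.head_mem_fiber c) (a.tail_mem_fiber c)
  · intro c hc d hd h
    exact a.eq_of_base_eq ((Finset.mem_filter.1 hc).2.trans (Finset.mem_filter.1 hd).2.symm)
      (congrArg Prod.fst h) (congrArg Prod.snd h)
  · rintro ⟨k, l⟩ h
    obtain ⟨hk, hl⟩ := Finset.mem_product.1 h
    obtain ⟨c, hc, rfl, rfl⟩ := a.exists_arrow_of_mem_fiber hb hk hl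
    exact ⟨c, Finset.mem_filter.2 ⟨Finset.mem_univ c, hc⟩, rfl⟩
  · exact fun _ _ => rfl

end Fibers

section SubstVertex

variable {V E : Type*} [DecidableEq V] [Fintype V] {Q : ArrowQuiver V E} {j : V} {s : ℕ}
  (a : Q.Fan j s)

theorem substVertex_eq_sum (i : V) :
    a.substVertex i = ∑ k ∈ a.fiber i, idem (Q.contract a).double k := by
  rw [substVertex]
  split_ifs with h
  · rw [h, fiber_eq_image, Finset.sum_image a.vertex_injective.injOn]
  · rw [a.fiber_eq_singleton ⟨i, h⟩, Finset.sum_singleton]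

theorem substVertex_mul_idem {i : V} {k : {i : V // i ≠ j}} (hk : k ∈ a.fiber i) :
    a.substVertex i * idem (Q.contract a).double k = idem (Q.contract a).double k := by
  rw [substVertex_eq_sum, Finset.sum_mul, Finset.sum_eq_single_of_mem k hk, idem_mul_idem_self]
  exact fun l _ hl => idem_mul_idem_of_ne hl

theorem idem_mul_substVertex {i : V} {k : {i : V // i ≠ j}} (hk : k ∈ a.fiber i) :
    idem (Q.contract a).double k * a.substVertex i = idem (Q.contract a).double k := by
  rw [substVertex_eq_sum, Finset.mul_sum, Finset.sum_eq_single_of_mem k hk, idem_mul_idem_self]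
  exact fun l _ hl => idem_mul_idem_of_ne hl.symm

theorem substVertex_mul_self (i : V) : a.substVertex i * a.substVertex i = a.substVertex i := by
  nth_rw 2 [substVertex_eq_sum]
  rw [Finset.mul_sum, Finset.sum_congr rfl fun k hk => a.substVertex_mul_idem hk,
    ← substVertex_eq_sum]

theorem substVertex_mem_homogeneous (i : V) :
    a.substVertex i ∈ (Q.contract a).homogeneous 0 := by
  rw [substVertex_eq_sum]
  exact sum_mem fun k _ => idem_mem_homogeneous k

theorem insertDeriv_substVertex (ε : ℂ) (c : a.Arrow ⊕ a.Arrow) (i : V) :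
    (Q.contract a).insertDeriv ε c (a.substVertex i) = 0 := by
  rw [substVertex_eq_sum, map_sum]
  exact Finset.sum_eq_zero fun k _ => insertDeriv_idem k

open Classical in
theorem sum_idem_head_mul_mul_idem_tail [Fintype E] {b : E} (hb : b ∈ a.remaining)
    (x : (Q.contract a).double.PathAlgebra) :
    ∑ c : a.Arrow with c.base = b, idem _ ((Q.contract a).head c) * x *
        idem _ ((Q.contract a).tail c) =
      a.substVertex (Q.head b) * x * a.substVertex (Q.tail b) := by
  rw [a.sum_arrow_eq_sum_fiber hb fun k l => idem _ k * x * idem _ l]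
  simp only [substVertex_eq_sum, Finset.sum_mul, Finset.mul_sum]
  exact Finset.sum_comm

end SubstVertex

variable {V E : Type*} [DecidableEq V] [Fintype V] [Fintype E] {Q : ArrowQuiver V E} {j : V}
  {s : ℕ} (a : Q.Fan j s)

section SubstArrow

theorem substArrow_inl_arr (m : Fin s) :
    a.substArrow (.inl (a.arr m)) = idem _ (a.vertex m) := by
  have h : ∃ n, a.arr n = a.arr m := ⟨m, rfl⟩
  rw [substArrow, dif_pos h, a.arr_injective h.choose_spec]

theorem substArrow_inr_arr (m : Fin s) : a.substArrow (.inr (a.arr m)) = a.dualValue m := by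
  have h : ∃ n, a.arr n = a.arr m := ⟨m, rfl⟩
  rw [substArrow, dif_pos h, a.arr_injective h.choose_spec]

theorem substArrow_inl_of_mem_remaining {b : E} (hb : b ∈ a.remaining) :
    a.substArrow (.inl b) = a.split b :=
  dif_neg (a.mem_remaining.1 hb)

theorem substArrow_inr_of_mem_remaining {b : E} (hb : b ∈ a.remaining) :
    a.substArrow (.inr b) = a.splitDual b :=
  dif_neg (a.mem_remaining.1 hb)

theorem substVertex_head_mul_split (b : E) :
    a.substVertex (Q.head b) * a.split b = a.split b := by
  classical
  rw [split, Finset.mul_sum]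
  refine Finset.sum_congr rfl fun c hc => ?_
  obtain rfl := (Finset.mem_filter.1 hc).2
  rw [← idem_mul_arrow, ← mul_assoc, double_head_inl, a.substVertex_mul_idem (a.head_mem_fiber c)]

theorem split_mul_substVertex_tail (b : E) :
    a.split b * a.substVertex (Q.tail b) = a.split b := by
  classical
  rw [split, Finset.sum_mul]
  refine Finset.sum_congr rfl fun c hc => ?_
  obtain rfl := (Finset.mem_filter.1 hc).2
  rw [← arrow_mul_idem, mul_assoc, double_tail_inl, a.idem_mul_substVertex (a.tail_mem_fiber c)]

theorem substVertex_tail_mul_splitDual (b : E) :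
    a.substVertex (Q.tail b) * a.splitDual b = a.splitDual b := by
  classical
  rw [splitDual, Finset.mul_sum]
  refine Finset.sum_congr rfl fun c hc => ?_
  obtain rfl := (Finset.mem_filter.1 hc).2
  rw [← idem_mul_arrow, ← mul_assoc, double_head_inr, a.substVertex_mul_idem (a.tail_mem_fiber c)]

theorem splitDual_mul_substVertex_head (b : E) :
    a.splitDual b * a.substVertex (Q.head b) = a.splitDual b := by
  classical
  rw [splitDual, Finset.sum_mul]
  refine Finset.sum_congr rfl fun c hc => ?_
  obtain rfl := (Finset.mem_filter.1 hc).2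
  rw [← arrow_mul_idem, mul_assoc, double_tail_inr, a.idem_mul_substVertex (a.head_mem_fiber c)]

/-- The element `∑ c_{b,i}* c_{b,l} - ∑ c_{b,i} c_{b,l}*`, over the remaining arrows `b` with
`t(b) = j` and `h(b) = j` respectively, whose summand `e_{v_m} a.moment` is substituted for
`a_m*`. -/
noncomputable def moment : (Q.contract a).double.PathAlgebra :=
  ∑ b ∈ a.remaining, ((if Q.tail b = j then a.splitDual b * a.split b else 0) -
    if Q.head b = j then a.split b * a.splitDual b else 0)

theorem dualValue_eq (m : Fin s) : a.dualValue m = idem _ (a.vertex m) * a.moment := by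
  classical
  have htail (b : E) : Q.tail b = j ↔ b ∈ a.remaining ∧ Q.tail b = j := by
    refine ⟨fun h => ⟨a.mem_remaining.2 ?_, h⟩, And.right⟩
    rintro ⟨m, rfl⟩
    exact a.tail_ne m h
  rw [dualValue, ← mul_sub, moment, Finset.sum_sub_distrib, ← Finset.sum_filter,
    ← Finset.sum_filter]
  congr 3
  · ext b
    simpa using htail b
  · ext b
    simp [mem_remaining, and_comm]

theorem moment_mem_homogeneous : a.moment ∈ (Q.contract a).homogeneous 1 := by
  refine sum_mem fun b _ => sub_mem ?_ ?_
  · split_ifs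
    · exact mul_mem_homogeneous (r := 1) (t := 0) (a.splitDual_mem b) (a.split_mem b)
    · exact zero_mem _
  · split_ifs
    · exact mul_mem_homogeneous (r := 0) (t := 1) (a.split_mem b) (a.splitDual_mem b)
    · exact zero_mem _

theorem moment_mul_substVertex : a.moment * a.substVertex j = a.moment := by
  rw [moment, Finset.sum_mul]
  refine Finset.sum_congr rfl fun b _ => ?_
  rw [sub_mul, ite_mul, ite_mul, zero_mul]
  congr 1
  · split_ifs with h
    · rw [mul_assoc, ← congrArg a.substVertex h, split_mul_substVertex_tail]
    · rfl
  · split_ifs with h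
    · rw [mul_assoc, ← congrArg a.substVertex h, splitDual_mul_substVertex_head]
    · rfl

end SubstArrow

section Realization

theorem substVertex_head_mul_substArrow (x : E ⊕ E) :
    a.substVertex (Q.double.head x) * a.substArrow x = a.substArrow x := by
  obtain b | b := x
  · by_cases hb : b ∈ Set.range a.arr
    · obtain ⟨m, rfl⟩ := hb
      rw [substArrow_inl_arr, double_head_inl, a.head_arr,
        a.substVertex_mul_idem (a.vertex_mem_fiber m)]
    · rw [a.substArrow_inl_of_mem_remaining (a.mem_remaining.2 hb)]
      exact a.substVertex_head_mul_split b
  · by_cases hb : b ∈ Set.range a.arr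
    · obtain ⟨m, rfl⟩ := hb
      rw [substArrow_inr_arr, dualValue_eq, ← mul_assoc]
      exact congrArg (· * a.moment) (a.substVertex_mul_idem (a.mem_fiber_self (a.vertex m)))
    · rw [a.substArrow_inr_of_mem_remaining (a.mem_remaining.2 hb)]
      exact a.substVertex_tail_mul_splitDual b

theorem substArrow_mul_substVertex_tail (x : E ⊕ E) :
    a.substArrow x * a.substVertex (Q.double.tail x) = a.substArrow x := by
  obtain b | b := x
  · by_cases hb : b ∈ Set.range a.arr
    · obtain ⟨m, rfl⟩ := hb
      rw [substArrow_inl_arr]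
      exact a.idem_mul_substVertex (a.mem_fiber_self (a.vertex m))
    · rw [a.substArrow_inl_of_mem_remaining (a.mem_remaining.2 hb)]
      exact a.split_mul_substVertex_tail b
  · by_cases hb : b ∈ Set.range a.arr
    · obtain ⟨m, rfl⟩ := hb
      rw [substArrow_inr_arr, dualValue_eq, double_tail_inr, a.head_arr, mul_assoc,
        moment_mul_substVertex]
    · rw [a.substArrow_inr_of_mem_remaining (a.mem_remaining.2 hb)]
      exact a.splitDual_mul_substVertex_head b

/-- The substitution on vertices and arrows, as a realization of the double quiver in the path
algebra of the contracted one. Its evaluation lifts the substitution on polyvector fields, see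
`subst_toPolyvector_of_idem`. -/
@[simps]
noncomputable def realization : Q.double.Realization (Q.contract a).double.PathAlgebra where
  onVertex := a.substVertex
  onArrow := a.substArrow
  vertex_mul_self := a.substVertex_mul_self
  head_mul_arrow := a.substVertex_head_mul_substArrow
  arrow_mul_tail := a.substArrow_mul_substVertex_tail

/-- The linear extension of the substitution to the path algebra. -/
noncomputable abbrev eval : Q.double.PathAlgebra →ₗ[ℂ] (Q.contract a).double.PathAlgebra :=
  a.realization.eval

theorem eval_ofPath_mem_homogeneous (p : Q.double.Path) :
    a.eval (ofPath p) ∈ (Q.contract a).homogeneous (dualCount p.word) := by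
  rw [a.realization.eval_ofPath, ← zero_add (dualCount p.word)]
  exact mul_mem_homogeneous (a.substVertex_mem_homogeneous p.tgt) (a.prod_substArrow_mem p.word)

theorem eval_mem_parityPart {x : Q.double.PathAlgebra} {r : ℕ} (hx : x ∈ Q.parityPart r) :
    a.eval x ∈ (Q.contract a).parityPart r := by
  refine Submodule.span_le (p := ((Q.contract a).parityPart r).comap a.eval).2 ?_ hx
  rintro _ ⟨p, hp, rfl⟩
  rw [← parityPart_congr hp]
  exact homogeneous_le_parityPart _ (a.eval_ofPath_mem_homogeneous p)

theorem subst_toPolyvector_ofPath {p : Q.double.Path} (h : p.tgt = p.src) :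
    a.subst (Q.toPolyvector (ofPath p)) = (Q.contract a).toPolyvector (a.eval (ofPath p)) := by
  have hlift : a.subst (Q.toPolyvector (ofPath p)) = a.substClosed p := lift_ofPath _ p
  rw [hlift, a.substClosed_closed h]
  congr 1
  induction p using Path.induction_cons with
  | trivial i => exact (a.realization.eval_idem i).symm
  | cons x p hx =>
    rw [a.realization.eval_cons, a.realization.eval_ofPath, ← hx, ← mul_assoc,
      a.realization.arrow_mul_tail]
    rfl

theorem subst_mem_polyvectorDegree {γ : Q.Polyvector} {r : ℕ} (hγ : γ ∈ Q.polyvectorDegree r) :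
    a.subst γ ∈ (Q.contract a).polyvectorDegree r := by
  rw [polyvectorDegree_eq_span] at hγ
  refine Submodule.span_le (p := ((Q.contract a).polyvectorDegree r).comap a.subst).2 ?_ hγ
  rintro _ ⟨p, hp, rfl, rfl⟩
  exact ⟨_, a.eval_ofPath_mem_homogeneous p, (a.subst_toPolyvector_ofPath hp).symm⟩

end Realization

section ChainRule

theorem insertDeriv_eval_ofPath (ε : ℂ) (c : a.Arrow ⊕ a.Arrow) (p : Q.double.Path)
    {z : Q.double.PathAlgebra} (hsrc : idem _ p.src * z = z) (htgt : z * idem _ p.tgt = z) :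
    (Q.contract a).insertDeriv ε c (a.eval (ofPath p)) (a.eval z) =
      ∑ w, (Q.contract a).insertDeriv ε c (a.substArrow w)
        (a.eval (Q.insertDeriv ε w (ofPath p) z)) := by
  classical
  induction p using Path.induction_cons generalizing z with
  | trivial i =>
    simp only [ofPath_trivial, a.realization.eval_idem, realization_onVertex,
      insertDeriv_substVertex, insertDeriv_idem, LinearMap.zero_apply, map_zero,
      Finset.sum_const_zero]
  | cons x p h ih =>
    rw [Path.cons_src] at hsrc
    rw [Path.cons_tgt] at htgt
    have hpz : a.eval (ofPath p) * a.eval z = a.eval (ofPath p * z) :=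
      (a.realization.eval_mul (ofPath_mul_idem p) hsrc).symm
    have hzx : a.eval z * a.substArrow x = a.eval (z * arrow _ x) := by
      rw [a.realization.eval_mul htgt (idem_mul_arrow x), a.realization.eval_arrow,
        realization_onArrow]
    have hx : idem _ (Q.double.tail x) * (ofPath p * z) * idem _ (Q.double.head x) =
        ofPath p * z := by
      rw [h, ← mul_assoc, idem_mul_ofPath, mul_assoc, htgt]
    have hfirst : ∑ w, (Q.contract a).insertDeriv ε c (a.substArrow w)
        (a.eval (Q.insertDeriv ε w (arrow _ x) (ofPath p * z))) =
        (Q.contract a).insertDeriv ε c (a.substArrow x) (a.eval (ofPath p * z)) := by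
      rw [Finset.sum_eq_single_of_mem x (Finset.mem_univ x), insertDeriv_arrow, if_pos rfl, hx]
      intro w _ hw
      rw [insertDeriv_arrow, if_neg hw.symm, map_zero, map_zero]
    rw [a.realization.eval_cons, insertDeriv_mul _ (a.eval_ofPath_mem_homogeneous p), hpz,
      realization_onArrow, hzx, ih (by rw [← mul_assoc, hsrc])
        (by rw [mul_assoc, ← h, arrow_mul_idem]), ← hfirst, Finset.smul_sum,
      ← Finset.sum_add_distrib]
    simp only [insertDeriv_cons, map_add, map_smul]

theorem superDeriv_subst {γ : Q.Polyvector} {r : ℕ} (hγ : γ ∈ Q.polyvectorDegree r)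
    (c : a.Arrow ⊕ a.Arrow) :
    (Q.contract a).superDeriv c (a.subst γ) =
      ∑ w, (Q.contract a).insertDeriv ((-1) ^ (r + 1)) c (a.substArrow w)
        (a.eval (Q.superDeriv w γ)) := by
  let rhs : Q.Polyvector →ₗ[ℂ] (Q.contract a).double.PathAlgebra :=
    ∑ w, (Q.contract a).insertDeriv ((-1) ^ (r + 1)) c (a.substArrow w) ∘ₗ a.eval ∘ₗ Q.superDeriv w
  suffices h : Set.EqOn ((Q.contract a).superDeriv c ∘ₗ a.subst) rhs (Q.polyvectorDegree r) by
    simpa only [rhs, LinearMap.comp_apply, LinearMap.sum_apply] using h hγ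
  refine eqOn_polyvectorDegree fun p hp hr => ?_
  have hone : (Q.contract a).insertDeriv ((-1) ^ (r + 1)) c (a.eval (ofPath p)) 1 =
      (Q.contract a).insertDeriv ((-1) ^ (r + 1)) c (a.eval (ofPath p))
        (a.eval (idem _ p.src)) := by
    have hx : a.eval (ofPath p) = a.eval (ofPath p) * a.substVertex p.src := by
      rw [← realization_onVertex, ← a.realization.eval_idem,
        ← a.realization.eval_mul (ofPath_mul_idem p) (idem_mul_idem_self _), ofPath_mul_idem]
    rw [hx]
    simp only [insertDeriv_mul _ (a.substVertex_mem_homogeneous p.src), pow_zero, one_smul,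
      insertDeriv_substVertex, LinearMap.zero_apply, add_zero, mul_one, a.realization.eval_idem,
      realization_onVertex, substVertex_mul_self]
  have hsource (w : E ⊕ E) : Q.superDeriv w (Q.toPolyvector (ofPath p)) =
      Q.insertDeriv ((-1) ^ (r + 1)) w (ofPath p) (idem _ p.src) := by
    rw [superDeriv_toPolyvector w (hr ▸ ofPath_mem_homogeneous p),
      ← insertDeriv_idem_mul p, mul_one]
  rw [LinearMap.comp_apply, a.subst_toPolyvector_ofPath hp,
    superDeriv_toPolyvector c (hr ▸ a.eval_ofPath_mem_homogeneous p), hone,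
    a.insertDeriv_eval_ofPath _ _ p (idem_mul_idem_self _) (hp ▸ idem_mul_idem_self _)]
  simp only [rhs, LinearMap.sum_apply, LinearMap.comp_apply, hsource]

end ChainRule

section ArrowDerivatives

variable (ε : ℂ) (c : a.Arrow) (b : E) (z : (Q.contract a).double.PathAlgebra)

open Classical in
theorem insertDeriv_inl_split :
    (Q.contract a).insertDeriv ε (.inl c) (a.split b) z = if c.base = b then
      idem _ ((Q.contract a).tail c) * z * idem _ ((Q.contract a).head c) else 0 := by
  simp only [split, map_sum, LinearMap.sum_apply, insertDeriv_arrow, Sum.inl.injEq,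
    Finset.sum_ite_eq', Finset.mem_filter_univ, double_tail_inl, double_head_inl]

open Classical in
theorem insertDeriv_inr_splitDual :
    (Q.contract a).insertDeriv ε (.inr c) (a.splitDual b) z = if c.base = b then
      idem _ ((Q.contract a).head c) * z * idem _ ((Q.contract a).tail c) else 0 := by
  simp only [splitDual, map_sum, LinearMap.sum_apply, insertDeriv_arrow, Sum.inr.injEq,
    Finset.sum_ite_eq', Finset.mem_filter_univ, double_tail_inr, double_head_inr]

theorem insertDeriv_inr_split : (Q.contract a).insertDeriv ε (.inr c) (a.split b) z = 0 := by
  classical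
  simp only [split, map_sum, LinearMap.sum_apply, insertDeriv_arrow, reduceCtorEq, if_false,
    Finset.sum_const_zero]

theorem insertDeriv_inl_splitDual :
    (Q.contract a).insertDeriv ε (.inl c) (a.splitDual b) z = 0 := by
  classical
  simp only [splitDual, map_sum, LinearMap.sum_apply, insertDeriv_arrow, reduceCtorEq, if_false,
    Finset.sum_const_zero]

theorem insertDeriv_inl_moment :
    (Q.contract a).insertDeriv ε (.inl c) a.moment z = idem _ ((Q.contract a).tail c) *
      ((if Q.tail c.base = j then z * a.splitDual c.base else 0) -
        if Q.head c.base = j then ε • (a.splitDual c.base * z) else 0) *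
      idem _ ((Q.contract a).head c) := by
  classical
  rw [moment, map_sum, LinearMap.sum_apply,
    Finset.sum_eq_single_of_mem c.base (a.base_mem_remaining c)]
  · by_cases hh : Q.head c.base = j <;> by_cases ht : Q.tail c.base = j <;>
    simp [hh, ht, insertDeriv_mul _ (a.split_mem _), insertDeriv_mul _ (a.splitDual_mem _),
      insertDeriv_inl_split, insertDeriv_inl_splitDual, mul_sub, sub_mul]
  · intro b _ hb
    by_cases hh : Q.head b = j <;> by_cases ht : Q.tail b = j <;>
    simp [hh, ht, insertDeriv_mul _ (a.split_mem _), insertDeriv_mul _ (a.splitDual_mem _),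
      insertDeriv_inl_split, insertDeriv_inl_splitDual, hb.symm]

theorem insertDeriv_inr_moment :
    (Q.contract a).insertDeriv ε (.inr c) a.moment z = idem _ ((Q.contract a).head c) *
      ((if Q.tail c.base = j then a.split c.base * z else 0) -
        if Q.head c.base = j then z * a.split c.base else 0) *
      idem _ ((Q.contract a).tail c) := by
  classical
  rw [moment, map_sum, LinearMap.sum_apply,
    Finset.sum_eq_single_of_mem c.base (a.base_mem_remaining c)]
  · by_cases hh : Q.head c.base = j <;> by_cases ht : Q.tail c.base = j <;>
    simp [hh, ht, insertDeriv_mul _ (a.split_mem _), insertDeriv_mul _ (a.splitDual_mem _),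
      insertDeriv_inr_split, insertDeriv_inr_splitDual, mul_sub, sub_mul]
  · intro b _ hb
    by_cases hh : Q.head b = j <;> by_cases ht : Q.tail b = j <;>
    simp [hh, ht, insertDeriv_mul _ (a.split_mem _), insertDeriv_mul _ (a.splitDual_mem _),
      insertDeriv_inr_split, insertDeriv_inr_splitDual, hb.symm]

end ArrowDerivatives

section SubstDerivatives

variable {γ : Q.Polyvector} {r : ℕ}

theorem eval_superDeriv_mul_substVertex (hγ : γ ∈ Q.polyvectorDegree r) (w : E ⊕ E) :
    a.eval (Q.superDeriv w γ) * a.substVertex (Q.double.head w) = a.eval (Q.superDeriv w γ) := by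
  have h := superDeriv_mul_idem w hγ
  rw [← realization_onVertex, ← a.realization.eval_idem,
    ← a.realization.eval_mul h (idem_mul_idem_self _), h]

theorem substVertex_mul_eval_superDeriv (hγ : γ ∈ Q.polyvectorDegree r) (w : E ⊕ E) :
    a.substVertex (Q.double.tail w) * a.eval (Q.superDeriv w γ) = a.eval (Q.superDeriv w γ) := by
  have h := idem_mul_superDeriv w hγ
  rw [← realization_onVertex, ← a.realization.eval_idem,
    ← a.realization.eval_mul (idem_mul_idem_self _) h, h]

theorem insertDeriv_dualValue (hγ : γ ∈ Q.polyvectorDegree r) (ε : ℂ) (c : a.Arrow ⊕ a.Arrow)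
    (m : Fin s) :
    (Q.contract a).insertDeriv ε c (a.dualValue m) (a.eval (Q.superDeriv (.inr (a.arr m)) γ)) =
      (Q.contract a).insertDeriv ε c a.moment (a.eval (Q.superDeriv (.inr (a.arr m)) γ)) := by
  have hv : a.substVertex (Q.tail (a.arr m)) = idem _ (a.vertex m) := dif_neg (a.tail_ne m)
  have h := a.eval_superDeriv_mul_substVertex hγ (.inr (a.arr m))
  rw [double_head_inr, hv] at h
  rw [dualValue_eq, insertDeriv_mul _ a.moment_mem_homogeneous, insertDeriv_idem,
    LinearMap.zero_apply, smul_zero, zero_add, h]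

/-- The sum over `m` of the derivatives by `a_m*`, after substitution. It accounts for the
dependence of a substituted polyvector field on the moment element. -/
noncomputable def fanDeriv (γ : Q.Polyvector) : (Q.contract a).double.PathAlgebra :=
  ∑ m, a.eval (Q.superDeriv (.inr (a.arr m)) γ)

/-- The joint derivative of the substituted polyvector field by the arrows `c_{b,i}`. -/
noncomputable def arrowDeriv (r : ℕ) (γ : Q.Polyvector) (b : E) :
    (Q.contract a).double.PathAlgebra :=
  a.eval (Q.superDeriv (.inl b) γ) +
    ((if Q.tail b = j then a.fanDeriv γ * a.splitDual b else 0) -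
      if Q.head b = j then (-1 : ℂ) ^ (r + 1) • (a.splitDual b * a.fanDeriv γ) else 0)

/-- The joint derivative of the substituted polyvector field by the dual arrows `c_{b,i}*`. -/
noncomputable def dualDeriv (γ : Q.Polyvector) (b : E) : (Q.contract a).double.PathAlgebra :=
  a.eval (Q.superDeriv (.inr b) γ) +
    ((if Q.tail b = j then a.split b * a.fanDeriv γ else 0) -
      if Q.head b = j then a.fanDeriv γ * a.split b else 0)

theorem superDeriv_subst_eq_sum_remaining (hγ : γ ∈ Q.polyvectorDegree r) (c : a.Arrow ⊕ a.Arrow) :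
    (Q.contract a).superDeriv c (a.subst γ) =
      ∑ b ∈ a.remaining, ((Q.contract a).insertDeriv ((-1) ^ (r + 1)) c (a.split b)
          (a.eval (Q.superDeriv (.inl b) γ)) +
        (Q.contract a).insertDeriv ((-1) ^ (r + 1)) c (a.splitDual b)
          (a.eval (Q.superDeriv (.inr b) γ))) +
      (Q.contract a).insertDeriv ((-1) ^ (r + 1)) c a.moment (a.fanDeriv γ) := by
  have hinl (b : E) (hb : b ∈ a.remaining) := a.substArrow_inl_of_mem_remaining hb
  have hinr (b : E) (hb : b ∈ a.remaining) := a.substArrow_inr_of_mem_remaining hb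
  rw [Finset.sum_congr rfl fun b hb => by rw [← hinl b hb, ← hinr b hb], a.superDeriv_subst hγ,
    Fintype.sum_sum_type, a.sum_eq_sum_arr_add_sum_remaining,
    a.sum_eq_sum_arr_add_sum_remaining, fanDeriv, map_sum, Finset.sum_add_distrib]
  simp only [substArrow_inl_arr, insertDeriv_idem, LinearMap.zero_apply, Finset.sum_const_zero,
    zero_add, substArrow_inr_arr, a.insertDeriv_dualValue hγ]
  abel

theorem superDeriv_inl_subst (hγ : γ ∈ Q.polyvectorDegree r) (c : a.Arrow) :
    (Q.contract a).superDeriv (.inl c) (a.subst γ) =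
      idem _ ((Q.contract a).tail c) * a.arrowDeriv r γ c.base *
        idem _ ((Q.contract a).head c) := by
  classical
  rw [a.superDeriv_subst_eq_sum_remaining hγ, insertDeriv_inl_moment, arrowDeriv, mul_add, add_mul]
  simp only [insertDeriv_inl_split, insertDeriv_inl_splitDual, add_zero, Finset.sum_ite_eq,
    a.base_mem_remaining c, if_true]

theorem superDeriv_inr_subst (hγ : γ ∈ Q.polyvectorDegree r) (c : a.Arrow) :
    (Q.contract a).superDeriv (.inr c) (a.subst γ) =
      idem _ ((Q.contract a).head c) * a.dualDeriv γ c.base *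
        idem _ ((Q.contract a).tail c) := by
  classical
  rw [a.superDeriv_subst_eq_sum_remaining hγ, insertDeriv_inr_moment, dualDeriv, mul_add, add_mul]
  simp only [insertDeriv_inr_split, insertDeriv_inr_splitDual, zero_add, Finset.sum_ite_eq,
    a.base_mem_remaining c, if_true]

end SubstDerivatives

section SubstProduct

theorem subst_toPolyvector_of_idem {x : Q.double.PathAlgebra} {i : V}
    (hl : idem _ i * x = x) (hr : x * idem _ i = x) :
    a.subst (Q.toPolyvector x) = (Q.contract a).toPolyvector (a.eval x) := by
  let corner : Q.double.PathAlgebra →ₗ[ℂ] Q.double.PathAlgebra :=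
    LinearMap.mulRight ℂ (idem _ i) ∘ₗ LinearMap.mulLeft ℂ (idem _ i)
  have hcorner : corner x = x := by
    simp only [corner, LinearMap.comp_apply, LinearMap.mulLeft_apply, LinearMap.mulRight_apply, hl,
      hr]
  suffices h : a.subst ∘ₗ Q.toPolyvector ∘ₗ corner =
      (Q.contract a).toPolyvector ∘ₗ a.eval ∘ₗ corner by
    simpa only [LinearMap.comp_apply, hcorner] using LinearMap.congr_fun h x
  refine hom_ext fun p => ?_
  have hp : corner (ofPath p) = idem _ i * ofPath p * idem _ i := rfl
  simp only [LinearMap.comp_apply, hp]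
  by_cases htgt : p.tgt = i
  · by_cases hsrc : p.src = i
    · rw [← htgt, idem_mul_ofPath, htgt, ← hsrc, ofPath_mul_idem,
        a.subst_toPolyvector_ofPath (htgt.trans hsrc.symm)]
    · rw [← ofPath_mul_idem p, mul_assoc, mul_assoc, idem_mul_idem_of_ne hsrc]
      simp only [mul_zero, map_zero]
  · rw [← idem_mul_ofPath p, ← mul_assoc, idem_mul_idem_of_ne (Ne.symm htgt)]
    simp only [zero_mul, map_zero]

theorem subst_toPolyvector_superDeriv_mul {γ δ : Q.Polyvector} {m n : ℕ}
    (hγ : γ ∈ Q.polyvectorDegree m) (hδ : δ ∈ Q.polyvectorDegree n) (b : E) :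
    a.subst (Q.toPolyvector (Q.superDeriv (.inr b) γ * Q.superDeriv (.inl b) δ)) =
      (Q.contract a).toPolyvector
        (a.eval (Q.superDeriv (.inr b) γ) * a.eval (Q.superDeriv (.inl b) δ)) := by
  have hl : idem _ (Q.head b) * Q.superDeriv (.inr b) γ = _ := idem_mul_superDeriv (.inr b) hγ
  have hr : Q.superDeriv (.inl b) δ * idem _ (Q.head b) = _ := superDeriv_mul_idem (.inl b) hδ
  rw [a.subst_toPolyvector_of_idem (by rw [← mul_assoc, hl]) (by rw [mul_assoc, hr]),
    a.realization.eval_mul (superDeriv_mul_idem (.inr b) hγ) (idem_mul_superDeriv (.inl b) hδ)]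

end SubstProduct

section VertexIdentity

variable {γ δ : Q.Polyvector} {m n : ℕ}

theorem substVertex_mul_fanDeriv (hγ : γ ∈ Q.polyvectorDegree m) :
    a.substVertex j * a.fanDeriv γ = a.fanDeriv γ := by
  rw [fanDeriv, Finset.mul_sum]
  refine Finset.sum_congr rfl fun k _ => ?_
  rw [← congrArg a.substVertex (a.head_arr k)]
  exact a.substVertex_mul_eval_superDeriv hγ (.inr (a.arr k))

theorem eval_superDeriv_mul_idem (hγ : γ ∈ Q.polyvectorDegree m) (k : Fin s) :
    a.eval (Q.superDeriv (.inr (a.arr k)) γ) * idem _ (a.vertex k) =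
      a.eval (Q.superDeriv (.inr (a.arr k)) γ) := by
  have h := a.eval_superDeriv_mul_substVertex hγ (.inr (a.arr k))
  have hv : a.substVertex (Q.double.head (.inr (a.arr k))) = idem _ (a.vertex k) :=
    dif_neg (a.tail_ne k)
  rwa [hv] at h

theorem fanDeriv_mul_substVertex (hγ : γ ∈ Q.polyvectorDegree m) :
    a.fanDeriv γ * a.substVertex j = a.fanDeriv γ := by
  rw [fanDeriv, Finset.sum_mul]
  refine Finset.sum_congr rfl fun k _ => ?_
  rw [← a.eval_superDeriv_mul_idem hγ k, mul_assoc, a.idem_mul_substVertex (a.vertex_mem_fiber k)]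

theorem substVertex_head_mul_dualDeriv (hγ : γ ∈ Q.polyvectorDegree m) (b : E) :
    a.substVertex (Q.head b) * a.dualDeriv γ b = a.dualDeriv γ b := by
  have h : a.substVertex (Q.head b) * _ = _ := a.substVertex_mul_eval_superDeriv hγ (.inr b)
  rw [dualDeriv, mul_add, mul_sub, mul_ite, mul_ite, mul_zero, h, ← mul_assoc,
    substVertex_head_mul_split]
  congr 2
  split_ifs with hj
  · rw [congrArg a.substVertex hj, ← mul_assoc, a.substVertex_mul_fanDeriv hγ]
  · rfl

theorem dualDeriv_mul_substVertex_tail (hγ : γ ∈ Q.polyvectorDegree m) (b : E) :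
    a.dualDeriv γ b * a.substVertex (Q.tail b) = a.dualDeriv γ b := by
  have h : _ * a.substVertex (Q.tail b) = _ := a.eval_superDeriv_mul_substVertex hγ (.inr b)
  rw [dualDeriv, add_mul, sub_mul, ite_mul, ite_mul, zero_mul, h, mul_assoc (a.fanDeriv γ),
    split_mul_substVertex_tail]
  congr 2
  split_ifs with hj
  · rw [congrArg a.substVertex hj, mul_assoc, a.fanDeriv_mul_substVertex hγ]
  · rfl

/-- The contribution of `b` to `∑ m, e_{v_m} D_{a_m}`, after substitution, when that sum is computed
from the vanishing of the sum of supercommutators `[w, D_w]` at the vertex `j`. -/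
noncomputable def commutatorTerm (r : ℕ) (γ : Q.Polyvector) (b : E) :
    (Q.contract a).double.PathAlgebra :=
  (if Q.tail b = j then a.eval (Q.superDeriv (.inl b) γ) * a.split b -
      (-1 : ℂ) ^ (r + 1) • (a.splitDual b * a.eval (Q.superDeriv (.inr b) γ)) +
      a.fanDeriv γ * (a.splitDual b * a.split b) else 0) +
    if Q.head b = j then a.eval (Q.superDeriv (.inr b) γ) * a.splitDual b -
      a.split b * a.eval (Q.superDeriv (.inl b) γ) -
      a.fanDeriv γ * (a.split b * a.splitDual b) else 0

theorem eval_arrow_mul_superDeriv (hγ : γ ∈ Q.polyvectorDegree m) (w : E ⊕ E) :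
    a.eval (arrow _ w * Q.superDeriv w γ) = a.substArrow w * a.eval (Q.superDeriv w γ) := by
  rw [a.realization.eval_mul (arrow_mul_idem w) (idem_mul_superDeriv w hγ),
    a.realization.eval_arrow, realization_onArrow]

theorem eval_superDeriv_mul_arrow (hγ : γ ∈ Q.polyvectorDegree m) (w : E ⊕ E) :
    a.eval (Q.superDeriv w γ * arrow _ w) = a.eval (Q.superDeriv w γ) * a.substArrow w := by
  rw [a.realization.eval_mul (superDeriv_mul_idem w hγ) (idem_mul_arrow w),
    a.realization.eval_arrow, realization_onArrow]

theorem sum_idem_mul_eval_superDeriv (hγ : γ ∈ Q.polyvectorDegree m) :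
    ∑ k, idem _ (a.vertex k) * a.eval (Q.superDeriv (.inl (a.arr k)) γ) =
      ∑ b ∈ a.remaining, a.commutatorTerm m γ b := by
  have hfan (k : Fin s) : a.eval (Q.superDeriv (.inr (a.arr k)) γ) * a.dualValue k =
      a.eval (Q.superDeriv (.inr (a.arr k)) γ) * a.moment := by
    rw [dualValue_eq, ← mul_assoc, a.eval_superDeriv_mul_idem hγ]
  have key := congrArg a.eval (sum_superDeriv_at_vertex hγ j)
  simp only [map_sum, map_add, map_sub, map_smul, map_zero, apply_ite a.eval,
    a.eval_arrow_mul_superDeriv hγ, a.eval_superDeriv_mul_arrow hγ] at key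
  rw [a.sum_eq_sum_arr_add_sum_remaining] at key
  simp only [a.head_arr, a.tail_ne, if_true, if_false, add_zero, substArrow_inl_arr,
    substArrow_inr_arr, hfan, Finset.sum_sub_distrib, ← Finset.sum_mul] at key
  rw [← fanDeriv, moment, Finset.mul_sum, sub_add_eq_add_sub, sub_eq_zero, ← eq_sub_iff_add_eq,
    ← Finset.sum_sub_distrib] at key
  rw [key]
  refine Finset.sum_congr rfl fun b hb => ?_
  rw [a.substArrow_inl_of_mem_remaining hb, a.substArrow_inr_of_mem_remaining hb, commutatorTerm]
  by_cases hh : Q.head b = j <;> by_cases ht : Q.tail b = j <;>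
    simp only [hh, ht, if_true, if_false, mul_sub, mul_zero] <;> abel

theorem fanDeriv_mul_sum_commutatorTerm (hγ : γ ∈ Q.polyvectorDegree m)
    (hδ : δ ∈ Q.polyvectorDegree n) :
    a.fanDeriv γ * ∑ b ∈ a.remaining, a.commutatorTerm n δ b =
      ∑ k, a.eval (Q.superDeriv (.inr (a.arr k)) γ) * a.eval (Q.superDeriv (.inl (a.arr k)) δ) := by
  rw [← a.sum_idem_mul_eval_superDeriv hδ, fanDeriv, Finset.sum_mul_sum]
  refine Finset.sum_congr rfl fun k _ => ?_
  rw [Finset.sum_eq_single_of_mem k (Finset.mem_univ k), ← mul_assoc,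
    a.eval_superDeriv_mul_idem hγ]
  intro l _ hl
  rw [← a.eval_superDeriv_mul_idem hγ, mul_assoc, ← mul_assoc (idem _ _),
    idem_mul_idem_of_ne (a.vertex_injective.ne hl.symm), zero_mul, mul_zero]

end VertexIdentity

section CrossTerm

variable {γ δ : Q.Polyvector} {m n : ℕ}

/-- The terms at `b` of the product `a.dualDeriv γ b * a.arrowDeriv r δ b`, up to cyclic rotation,
which are not accounted for by the derivatives of `γ` and `δ` themselves. They are supersymmetric in
`γ` and `δ`, so they cancel in the Schouten bracket. -/
noncomputable def crossTerm (r : ℕ) (γ δ : Q.Polyvector) (b : E) :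
    (Q.contract a).double.PathAlgebra :=
  let pairing := crossPairing (A := (Q.contract a).double.PathAlgebra) ((-1) ^ (r + 1))
  let Dγ := a.eval (Q.superDeriv (.inr b) γ)
  let Dδ := a.eval (Q.superDeriv (.inr b) δ)
  let x := a.split b
  let y := a.splitDual b
  (if Q.tail b = j then pairing Dγ (a.fanDeriv γ) Dδ (a.fanDeriv δ) y else 0) +
    ((if Q.head b = j then
      pairing (a.fanDeriv γ) (a.fanDeriv γ) (a.fanDeriv δ) (a.fanDeriv δ) (x * y) -
        pairing (a.fanDeriv γ) Dγ (a.fanDeriv δ) Dδ y else 0) -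
    if Q.tail b = j ∧ Q.head b = j then
      pairing (a.fanDeriv γ) (x * a.fanDeriv γ) (a.fanDeriv δ) (x * a.fanDeriv δ) y else 0)

theorem eval_superDeriv_inr_mem_parityPart (hγ : γ ∈ Q.polyvectorDegree m) (b : E) :
    a.eval (Q.superDeriv (.inr b) γ) ∈ (Q.contract a).parityPart (m + 1) :=
  a.eval_mem_parityPart (superDeriv_mem_parityPart (.inr b) hγ)

theorem fanDeriv_mem_parityPart (hγ : γ ∈ Q.polyvectorDegree m) :
    a.fanDeriv γ ∈ (Q.contract a).parityPart (m + 1) :=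
  sum_mem fun k _ => a.eval_superDeriv_inr_mem_parityPart hγ (a.arr k)

theorem toPolyvector_crossTerm_comm (hγ : γ ∈ Q.polyvectorDegree m) (hδ : δ ∈ Q.polyvectorDegree n)
    (b : E) :
    (Q.contract a).toPolyvector (a.crossTerm n γ δ b) =
      (-1 : ℂ) ^ ((m + 1) * (n + 1)) • (Q.contract a).toPolyvector (a.crossTerm m δ γ b) := by
  have hx := homogeneous_le_parityPart 0 (a.split_mem b)
  have hy := homogeneous_le_parityPart 1 (a.splitDual_mem b)
  have hxy := mul_mem_parityPart hx hy
  have hDγ := a.eval_superDeriv_inr_mem_parityPart hγ b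
  have hDδ := a.eval_superDeriv_inr_mem_parityPart hδ b
  have hfγ := a.fanDeriv_mem_parityPart hγ
  have hfδ := a.fanDeriv_mem_parityPart hδ
  have hxfγ := mul_mem_parityPart hx hfγ
  have hxfδ := mul_mem_parityPart hx hfδ
  rw [zero_add] at hxy hxfγ hxfδ
  simp only [crossTerm, map_add, map_sub, apply_ite (Q.contract a).toPolyvector, map_zero,
    smul_add, smul_sub, smul_ite, smul_zero, toPolyvector_crossPairing_comm hDγ hfγ hDδ hfδ hy,
    toPolyvector_crossPairing_comm hfγ hfγ hfδ hfδ hxy,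
    toPolyvector_crossPairing_comm hfγ hDγ hfδ hDδ hy,
    toPolyvector_crossPairing_comm hfγ hxfγ hfδ hxfδ hy]

theorem dualDeriv_mul_arrowDeriv (n : ℕ) (γ δ : Q.Polyvector) (b : E) :
    a.dualDeriv γ b * a.arrowDeriv n δ b =
      a.eval (Q.superDeriv (.inr b) γ) * a.eval (Q.superDeriv (.inl b) δ) +
        a.fanDeriv γ * a.commutatorTerm n δ b + a.crossTerm n γ δ b +
        if Q.tail b = j then
          ⁅a.split b, a.fanDeriv γ * (a.eval (Q.superDeriv (.inl b) δ) +
            a.fanDeriv δ * a.splitDual b)⁆ else 0 :=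
  mul_eq_add_crossPairing_add_lie _ _ _ _ _ _ _ _ _ _

theorem toPolyvector_dualDeriv_mul_arrowDeriv (n : ℕ) (γ δ : Q.Polyvector) (b : E) :
    (Q.contract a).toPolyvector (a.dualDeriv γ b * a.arrowDeriv n δ b) =
      (Q.contract a).toPolyvector
        (a.eval (Q.superDeriv (.inr b) γ) * a.eval (Q.superDeriv (.inl b) δ) +
          a.fanDeriv γ * a.commutatorTerm n δ b + a.crossTerm n γ δ b) := by
  rw [dualDeriv_mul_arrowDeriv, map_add _ (_ + _), add_eq_left]
  split_ifs
  · rw [Ring.lie_def, map_sub, toPolyvector_mul_comm_of_even (a.split_mem b), sub_self]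
  · exact map_zero _

end CrossTerm

section Bracket

variable {γ δ : Q.Polyvector} {m n : ℕ}

theorem toPolyvector_superDeriv_subst_mul (hγ : γ ∈ Q.polyvectorDegree m)
    (hδ : δ ∈ Q.polyvectorDegree n) (c : a.Arrow) :
    (Q.contract a).toPolyvector ((Q.contract a).superDeriv (.inr c) (a.subst γ) *
        (Q.contract a).superDeriv (.inl c) (a.subst δ)) =
      (Q.contract a).toPolyvector (idem _ ((Q.contract a).head c) * a.dualDeriv γ c.base *
        idem _ ((Q.contract a).tail c) * a.arrowDeriv n δ c.base) := by
  rw [a.superDeriv_inr_subst hγ, a.superDeriv_inl_subst hδ, ← mul_assoc,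
    ← toPolyvector_mul_comm_of_even (idem_mem_homogeneous _)]
  simp only [← mul_assoc, idem_mul_idem_self]
  rw [mul_assoc _ (idem _ _) (idem _ _), idem_mul_idem_self]

theorem toPolyvector_sum_superDeriv_subst_mul (hγ : γ ∈ Q.polyvectorDegree m)
    (hδ : δ ∈ Q.polyvectorDegree n) :
    (Q.contract a).toPolyvector (∑ c, (Q.contract a).superDeriv (.inr c) (a.subst γ) *
        (Q.contract a).superDeriv (.inl c) (a.subst δ)) =
      (Q.contract a).toPolyvector (∑ b ∈ a.remaining, a.dualDeriv γ b * a.arrowDeriv n δ b) := by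
  classical
  rw [map_sum, map_sum, ← Finset.sum_fiberwise_of_maps_to fun c _ => a.base_mem_remaining c]
  refine Finset.sum_congr rfl fun b hb => ?_
  rw [← a.dualDeriv_mul_substVertex_tail hγ, ← a.substVertex_head_mul_dualDeriv hγ,
    ← a.sum_idem_head_mul_mul_idem_tail hb, Finset.sum_mul, map_sum]
  refine Finset.sum_congr rfl fun c hc => ?_
  rw [a.toPolyvector_superDeriv_subst_mul hγ hδ, (Finset.mem_filter.1 hc).2]

theorem toPolyvector_sum_superDeriv_subst_mul_eq_add_crossTerm (hγ : γ ∈ Q.polyvectorDegree m)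
    (hδ : δ ∈ Q.polyvectorDegree n) :
    (Q.contract a).toPolyvector (∑ c, (Q.contract a).superDeriv (.inr c) (a.subst γ) *
        (Q.contract a).superDeriv (.inl c) (a.subst δ)) =
      a.subst (Q.toPolyvector (∑ b, Q.superDeriv (.inr b) γ * Q.superDeriv (.inl b) δ)) +
        ∑ b ∈ a.remaining, (Q.contract a).toPolyvector (a.crossTerm n γ δ b) := by
  rw [a.toPolyvector_sum_superDeriv_subst_mul hγ hδ, map_sum, map_sum, map_sum]
  simp only [a.subst_toPolyvector_superDeriv_mul hγ hδ, toPolyvector_dualDeriv_mul_arrowDeriv,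
    map_add, Finset.sum_add_distrib]
  rw [a.sum_eq_sum_arr_add_sum_remaining, ← map_sum _ _ Finset.univ,
    ← a.fanDeriv_mul_sum_commutatorTerm hγ hδ, Finset.mul_sum, map_sum]
  abel

theorem subst_schouten (hγ : γ ∈ Q.polyvectorDegree m) (hδ : δ ∈ Q.polyvectorDegree n) :
    a.subst (Q.schouten m n γ δ) = (Q.contract a).schouten m n (a.subst γ) (a.subst δ) := by
  rw [schouten_eq_sub, schouten_eq_sub, map_sub, map_smul,
    a.toPolyvector_sum_superDeriv_subst_mul_eq_add_crossTerm hγ hδ,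
    a.toPolyvector_sum_superDeriv_subst_mul_eq_add_crossTerm hδ hγ, smul_add, Finset.smul_sum,
    Finset.sum_congr rfl fun b _ => a.toPolyvector_crossTerm_comm hγ hδ b, add_sub_add_right_eq_sub]

end Bracket

end Fan

end ArrowQuiver

theorem mainTheorem5 {V E : Type*} [DecidableEq V] [Fintype V] [Fintype E]
    (Q : ArrowQuiver V E) (j : V) (s : ℕ) (a : Q.Fan j s) (P : Q.Polyvector)
    (hP : Q.IsPoisson P) : (Q.contract a).IsPoisson (a.subst P) := by
  refine ⟨a.subst_mem_polyvectorDegree hP.1, ?_⟩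
  rw [← a.subst_schouten hP.1 hP.1, hP.2, map_zero]
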